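/- Let $n\ge 1$ and let $K$ be either $\mathbb{C}$ or the field $\mathbb{K}$ of generalized Puiseux series $a(t)=\sum_{j\in A_a}\xi_j t^j$ with $\xi_j\in\mathbb{C}^*$ and $A_a\subset\mathbb{R}$ well-ordered. On $K^*$ let $\nu(z)=\log|z|$ and $\operatorname{Arg}(\rho e^{i\gamma})=e^{i\gamma}$ if $K=\mathbb{C}$, and let $\nu(a)=\operatorname{val}(a)=-\min A_a$ and $\operatorname{Arg}(a)=\operatorname{Arg}(\xi_{\min A_a})$ if $K=\mathbb{K}$. Both maps are applied coordinatewise to points of $(K^*)^n$. For a Laurent polynomial $f$ in $n$ variables over $K$ with zero set $V_f\subset (K^*)^n$, the amoeba is $\mathscr{A}_f=\nu(V_f)\subset\mathbb{R}^n$, the coamoeba is $co\mathscr{A}_f=\operatorname{Arg}(V_f)\subset (S^1)^n$, and $\widetilde{co\mathscr{A}}_f\subset\mathbb{R}^n$ denotes the inverse image of $co\mathscr{A}_f$ under the universal covering $x\mapsto(e^{ix_1},\dots,e^{ix_n})$. Let $P_1$ be the standard hyperplane $1+z_1+\dots+z_n=0$ in $(K^*)^n$, with amoeba $\mathscr{A}_{P_1}$,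 coamoeba $co\mathscr{A}_{P_1}$ and lifted coamoeba $\widetilde{co\mathscr{A}}_{P_1}$. Let $f$ be a Laurent polynomial whose Newton polytope $\Delta$ is an $n$-dimensional simplex and whose support is exactly the set of vertices of $\Delta$. Write $f=\sum_{k=0}^n c_k z^{\alpha_k}$, with the vertices $\alpha_0,\dots,\alpha_n$ labelled in any order. Let $a_k=c_k/c_0$ for $1\le k\le n$, and let $L$ be the integer $n\times n$ matrix with columns $\alpha_k-\alpha_0$, $1\le k\le n$. Let $\gamma\in\mathbb{R}^n$ be any vector of arguments of $a=(a_1,\dots,a_n)$, that is, $e^{i\gamma_k}=\operatorname{Arg}(a_k)$ for all $k$. Then $L$ is invertible over $\mathbb{R}$, and, with $\tau_v$ the translation $x\mapsto x+v$: (i) $\mathscr{A}_f={}^tL^{-1}\circ\tau_{\nu(a)}^{-1}\,(\mathscr{A}_{P_1})$. In particular $\mathscr{A}_f$ is solid, i.e. the number of connected components of $\mathbb{R}^n\setminus\mathscr{A}_f$ equals the number of vertices of $\Delta$. (ii) $\widetilde{co\mathscr{A}}_f={}^tL^{-1}\circ\tau_{\gamma}^{-1}\,(\widetilde{co\mathscr{A}}_{P_1})$.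 In particular the number of connected components of the complement of $co\mathscr{A}_f$ in $(S^1)^n$ is equal to $n!\operatorname{Vol}(\Delta)$, and so is the number of connected components of the complement of its closure $\overline{co\mathscr{A}_f}$. -/

import Mathlib

open scoped Nat ENNReal Matrix

noncomputable section

namespace Amoeba

/-- Laurent polynomials in `n` variables over `K`. -/
abbrev LaurentPoly (K : Type*) [Field K] (n : ℕ) : Type _ := AddMonoidAlgebra K (Fin n → ℤ)

/-- Generalized Puiseux series with real exponents and complex coefficients: formal series
`∑ ξ_j t ^ j` whose set of exponents is a well-ordered subset of `ℝ`. -/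
abbrev Puiseux : Type := HahnSeries ℝ ℂ

section General

variable {K : Type*} [Field K] {n : ℕ}

/-- The support of a Laurent polynomial: the exponents with non-zero coefficient. -/
def supp (f : LaurentPoly K n) : Set (Fin n → ℤ) := {α | f.coeff α ≠ 0}

/-- The value of a Laurent polynomial at a point of the torus `(K^*)^n`. -/
def eval (f : LaurentPoly K n) (z : Fin n → Kˣ) : K :=
  f.coeff.sum fun α c => c * ((∏ j, z j ^ α j : Kˣ) : K)

/-- The hypersurface `V_f` in the torus `(K^*)^n`. -/
def hypersurface (f : LaurentPoly K n) : Set (Fin n → Kˣ) := {z | eval f z = 0}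

/-- The Laurent polynomial `1 + z_1 + ... + z_n`; its hypersurface is the standard
hyperplane `P_1`. -/
def stdPoly (K : Type*) [Field K] (n : ℕ) : LaurentPoly K n :=
  AddMonoidAlgebra.single 0 1 + ∑ j : Fin n, AddMonoidAlgebra.single (Pi.single j 1) 1

/-- The lattice point `α ∈ ℤ^n` as a point of `ℝ^n`. -/
def toReal (α : Fin n → ℤ) : Fin n → ℝ := fun j => (α j : ℝ)

/-- The Newton polytope: the convex hull in `ℝ^n` of the support. -/
def newtonPolytope (f : LaurentPoly K n) : Set (Fin n → ℝ) :=
  convexHull ℝ (toReal '' supp f)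

/-- `P` is an `n`-dimensional simplex in `ℝ^n`. -/
def IsSimplex (P : Set (Fin n → ℝ)) : Prop :=
  ∃ p : Fin (n + 1) → Fin n → ℝ, AffineIndependent ℝ p ∧ P = convexHull ℝ (Set.range p)

/-- The amoeba of `V_f`, with respect to a map `ν` from `K^*` to `ℝ`
(the logarithm of the absolute value, or the valuation), applied coordinatewise. -/
def amoeba (ν : Kˣ → ℝ) (f : LaurentPoly K n) : Set (Fin n → ℝ) :=
  (fun z j => ν (z j)) '' hypersurface f

/-- The coamoeba of `V_f` in the real torus `(S^1)^n`, with respect to an argument map `θ`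
from `K^*` to `S^1`, applied coordinatewise. -/
def coamoeba (θ : Kˣ → Circle) (f : LaurentPoly K n) : Set (Fin n → Circle) :=
  (fun z j => θ (z j)) '' hypersurface f

/-- `α` lists the points of the support of `f` without repetition, and `c` lists the
corresponding coefficients, so that `f = ∑ k, c k * z ^ α k`. -/
def IsLabelling (f : LaurentPoly K n) (α : Fin (n + 1) → Fin n → ℤ)
    (c : Fin (n + 1) → Kˣ) : Prop :=
  Function.Injective α ∧ Set.range α = supp f ∧ ∀ k, (c k : K) = f.coeff (α k)

end General

variable {n : ℕ}

/-- The inverse image of a subset of the real torus in its universal covering `ℝ^n`. -/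
def lift (S : Set (Fin n → Circle)) : Set (Fin n → ℝ) :=
  {x | (fun j => Circle.exp (x j)) ∈ S}

/-- An amoeba `A` of a hypersurface with Newton polytope `Δ` is solid if its complement has
exactly as many connected components as `Δ` has vertices. -/
def IsSolid (A Δ : Set (Fin n → ℝ)) : Prop :=
  ENat.card (ConnectedComponents (Aᶜ : Set (Fin n → ℝ))) = (Δ.extremePoints ℝ).encard

/-- The matrix `L` with columns `α 1 - α 0, ..., α n - α 0`: the linear part of the affine map
that sends `0, e_1, ..., e_n` to `α 0, α 1, ..., α n`. -/
def simplexMatrix (α : Fin (n + 1) → Fin n → ℤ) : Matrix (Fin n) (Fin n) ℝ :=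
  Matrix.of fun j k => ((α k.succ j - α 0 j : ℤ) : ℝ)

/-- The composition of the translation by `-v` followed by the inverse of the transpose
of `L`. -/
def pullMap (L : Matrix (Fin n) (Fin n) ℝ) (v : Fin n → ℝ) (x : Fin n → ℝ) : Fin n → ℝ :=
  (Lᵀ)⁻¹ *ᵥ (x - v)

/-- `log |z|` on `ℂ^*`. -/
def logC (z : ℂˣ) : ℝ := Real.log ‖(z : ℂ)‖

/-- `z ↦ z / |z|` on `ℂ^*`, that is `ρ e^{iγ} ↦ e^{iγ}`. -/
def argC (z : ℂˣ) : Circle := Circle.exp (Complex.arg (z : ℂ))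

/-- The valuation `val a = - min A_a` on non-zero Puiseux series. -/
def valP (z : Puiseuxˣ) : ℝ := -(z : Puiseux).order

/-- The argument of the leading coefficient (the coefficient of the term of least exponent)
of a non-zero Puiseux series. -/
def argP (z : Puiseuxˣ) : Circle := Circle.exp (Complex.arg (z : Puiseux).leadingCoeff)

end Amoeba

end

/-!
The Laurent polynomial is the pull-back of `1 + z_1 + ... + z_n` under a monomial map: dividing `f`
by its first term gives `1 + ∑ a_k z ^ (α_k - α_0)`, so `z` is on `V_f` if and only if the point
`(a_k z ^ (α_k - α_0))_k` is on the standard hyperplane `P_1` (`mem_hypersurface_iff`). Since `K^*`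
is divisible, the monomial map is surjective (`monomialMap_surjective`), and the same holds on the
kernel of the argument map. Applying the valuation and the argument coordinatewise turns the
monomial map into an affine map with linear part the transpose of `L`, which gives the formulas for
the amoeba (`amoeba_eq_image_pullMap`) and for the coamoeba (`coamoeba_eq_preimage`,
`lift_preimage_monomialMap`). For generalized Puiseux series, divisibility follows from the binomial
series.

The complement of the amoeba of `P_1` consists of the points at which one of the `n + 1` terms
dominates: its absolute value is larger than the sum of those of the others over `ℂ`, its valuation
is larger than those of the others over Puiseux series. These are `n + 1` disjoint open convex sets.

The coamoeba of `P_1` is the set of the `u` such that `1, u_1, ..., u_n` have a linear relation with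
positive coefficients (over `ℂ`), or a nontrivial one with nonnegative coefficients (over Puiseux
series); the latter set is the closure of the former (`closure_posRelation`). By the theorems of
Stiemke and Gordan, the complement consists of the `u` such that `1, u_1, ..., u_n` lie in a common
half-plane, closed (but not all on its boundary line) or open. In terms of the phases
`-π/2 ≤ x_k ≤ π/2` relative to the axis of the half-plane, the complement is the image of a
star-shaped set of points `(x_j - x_0)_j`, whose translates by `(2πℤ)^n` do not meet each other's
closures (`period_eq_zero_of_phaseDiff`). Its preimage under the monomial map of the torus hence
has one component for each coset of `ℤ^n` modulo the lattice generated by the rows of `L`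
(`card_connectedComponents_preimage_monomialMap`); there are `|det L| = n! Vol(Δ)` of them. The
monomial map of the torus is open, so taking preimages commutes with closure, and the count for
the closure is the same one with open half-planes.
-/

namespace Amoeba

/-! ### Counting connected components -/

/-- A partition into connected open sets is the partition into connected components. -/
theorem card_connectedComponents_of_partition {X ι : Type*} [TopologicalSpace X] {R : ι → Set X}
    (hopen : ∀ i, IsOpen (R i)) (hconn : ∀ i, IsConnected (R i))
    (hdisj : ∀ i j, i ≠ j → Disjoint (R i) (R j)) (hcover : ⋃ i, R i = Set.univ) :
    ENat.card (ConnectedComponents X) = ENat.card ι := by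
  have hclopen : ∀ i, IsClopen (R i) := by
    refine fun i => ⟨⟨?_⟩, hopen i⟩
    have : (R i)ᶜ = ⋃ j ∈ {j | j ≠ i}, R j := by
      ext x
      obtain ⟨j, hj⟩ := Set.mem_iUnion.1 (hcover ▸ Set.mem_univ x : x ∈ ⋃ i, R i)
      simp only [Set.mem_compl_iff, Set.mem_iUnion, Set.mem_ofPred_eq, exists_prop]
      refine ⟨fun h => ⟨j, fun e => h (e ▸ hj), hj⟩, ?_⟩
      rintro ⟨k, hk, hx⟩ hi
      exact Set.disjoint_left.1 (hdisj k i hk) hx hi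
    rw [this]
    exact isOpen_biUnion fun j _ => hopen j
  choose x hx using fun i => (hconn i).nonempty
  refine (ENat.card_congr
    (Equiv.ofBijective (fun i => (x i : ConnectedComponents X)) ⟨?_, ?_⟩)).symm
  · intro i j hij
    by_contra hne
    have h1 : x j ∈ connectedComponent (x i) := by
      rw [ConnectedComponents.coe_eq_coe.1 hij]; exact mem_connectedComponent
    exact Set.disjoint_left.1 (hdisj i j hne)
      ((hclopen i).connectedComponent_subset (hx i) h1) (hx j)
  · intro c
    obtain ⟨y, rfl⟩ := ConnectedComponents.surjective_coe c
    obtain ⟨i, hi⟩ := Set.mem_iUnion.1 (hcover ▸ Set.mem_univ y : y ∈ ⋃ i, R i)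
    refine ⟨i, ConnectedComponents.coe_eq_coe'.2 ?_⟩
    exact (hconn i).isPreconnected.subset_connectedComponent hi (hx i)

/-- A subspace that is partitioned into connected relatively open sets has them as its
components. -/
theorem card_connectedComponents_subset {X ι : Type*} [TopologicalSpace X] {S : Set X}
    {R O : ι → Set X} (hopen : ∀ i, IsOpen (O i)) (hO : ∀ i, R i = S ∩ O i)
    (hconn : ∀ i, IsConnected (R i)) (hdisj : ∀ i j, i ≠ j → Disjoint (R i) (R j))
    (hcover : S ⊆ ⋃ i, R i) :
    ENat.card (ConnectedComponents S) = ENat.card ι := by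
  have himg : ∀ i, ((↑) : S → X) '' (((↑) : S → X) ⁻¹' R i) = R i := fun i => by
    rw [Subtype.image_preimage_coe, Set.inter_eq_right, hO]; exact Set.inter_subset_left
  refine card_connectedComponents_of_partition (R := fun i => ((↑) : S → X) ⁻¹' R i)
    (fun i => ?_) (fun i => ⟨?_, ?_⟩) (fun i j hij => (hdisj i j hij).preimage _) ?_
  · rw [hO]
    have : ((↑) : S → X) ⁻¹' (S ∩ O i) = ((↑) : S → X) ⁻¹' (O i) := by ext x; simp
    rw [this]
    exact (hopen i).preimage continuous_subtype_val
  · exact Set.image_nonempty.1 ((himg i).symm ▸ (hconn i).nonempty)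
  · exact Topology.IsInducing.subtypeVal.isPreconnected_image.1
      ((himg i).symm ▸ (hconn i).isPreconnected)
  · refine Set.eq_univ_of_forall fun x => ?_
    obtain ⟨i, hi⟩ := Set.mem_iUnion.1 (hcover x.2)
    exact Set.mem_iUnion.2 ⟨i, hi⟩

/-- For a finite partition of a subspace into connected sets it is enough that they are relatively
closed. -/
theorem card_connectedComponents_subset_of_isClosed {X ι : Type*} [TopologicalSpace X] [Finite ι]
    {S : Set X} {R F : ι → Set X} (hclosed : ∀ i, IsClosed (F i)) (hF : ∀ i, R i = S ∩ F i)
    (hconn : ∀ i, IsConnected (R i)) (hdisj : ∀ i j, i ≠ j → Disjoint (R i) (R j))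
    (hcover : S ⊆ ⋃ i, R i) :
    ENat.card (ConnectedComponents S) = ENat.card ι := by
  refine card_connectedComponents_subset (O := fun i => (⋃ j ∈ {j | j ≠ i}, F j)ᶜ) (fun i => ?_)
    (fun i => ?_) hconn hdisj hcover
  · rw [isOpen_compl_iff]
    exact (Set.toFinite _).isClosed_biUnion fun j _ => hclosed j
  · ext x
    simp only [Set.mem_inter_iff, Set.mem_compl_iff, Set.mem_iUnion, Set.mem_ofPred_eq, exists_prop,
      not_exists, not_and]
    constructor
    · intro hx
      refine ⟨(hF i ▸ hx).1, fun j hj hxj => ?_⟩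
      exact Set.disjoint_left.1 (hdisj j i hj) (by rw [hF j]; exact ⟨(hF i ▸ hx).1, hxj⟩) hx
    · rintro ⟨hS, h⟩
      obtain ⟨j, hj⟩ := Set.mem_iUnion.1 (hcover hS)
      by_cases hji : j = i
      · exact hji ▸ hj
      · exact absurd (hF j ▸ hj).2 (h j hji)

/-! ### Monomial maps and the real torus -/

variable {n : ℕ}

/-- The universal covering `x ↦ (e^{ix_1}, ..., e^{ix_n})` of the real torus. -/
noncomputable def torusExp (x : Fin n → ℝ) : Fin n → Circle := fun j => Circle.exp (x j)

theorem torusExp_surjective : Function.Surjective (torusExp (n := n)) := fun u => by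
  choose x hx using fun j => Circle.exp_surjective (u j)
  exact ⟨x, funext hx⟩

theorem continuous_torusExp : Continuous (torusExp (n := n)) :=
  continuous_pi fun j => Circle.exp.continuous.comp (continuous_apply j)

theorem isOpenMap_torusExp : IsOpenMap (torusExp (n := n)) :=
  IsOpenMap.piMap (fun _ => isLocalHomeomorph_circleExp.isOpenMap)
    (Filter.Eventually.of_forall fun _ => Circle.exp_surjective)

/-- The point of the period lattice `(2πℤ)^n` given by an integer vector. -/
noncomputable def period (k : Fin n → ℤ) : Fin n → ℝ := fun j => k j * (2 * Real.pi)

theorem torusExp_eq_iff {x y : Fin n → ℝ} :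
    torusExp x = torusExp y ↔ ∃ k, x = y + period k := by
  simp only [torusExp, funext_iff, Circle.exp_eq_exp, period, Pi.add_apply]
  exact Classical.skolem

/-- The map `z ↦ (b_k ∏_j z_j ^ ℓ_{jk})_k` of the `n`-th power of a commutative group. -/
def monomialMap {G : Type*} [CommGroup G] (ℓ : Matrix (Fin n) (Fin n) ℤ) (b z : Fin n → G) :
    Fin n → G := fun k => b k * ∏ j, z j ^ ℓ j k

theorem map_monomialMap {G H : Type*} [CommGroup G] [CommGroup H] (θ : G →* H)
    (ℓ : Matrix (Fin n) (Fin n) ℤ) (b z : Fin n → G) :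
    (fun k => θ (monomialMap ℓ b z k)) =
      monomialMap ℓ (fun k => θ (b k)) (fun k => θ (z k)) := by
  funext k; simp [monomialMap]

theorem monomialMap_torusExp (ℓ : Matrix (Fin n) (Fin n) ℤ) (γ x : Fin n → ℝ) :
    monomialMap ℓ (torusExp γ) (torusExp x) =
      torusExp ((ℓ.map (Int.cast : ℤ → ℝ))ᵀ *ᵥ x + γ) := by
  have hsum : ∀ f : Fin n → ℝ, Circle.exp (∑ j, f j) = ∏ j, Circle.exp (f j) := fun f =>
    map_sum Circle.expHom f Finset.univ
  funext k
  simp only [monomialMap, torusExp, Matrix.mulVec, dotProduct, Pi.add_apply, Circle.exp_add, hsum,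
    Matrix.transpose_apply, Matrix.map_apply, Circle.exp_intCast_mul]
  exact mul_comm _ _

theorem mulVec_period (ℓ : Matrix (Fin n) (Fin n) ℤ) (k : Fin n → ℤ) :
    (ℓ.map (Int.cast : ℤ → ℝ)) *ᵥ period k = period (ℓ *ᵥ k) := by
  funext j
  simp [Matrix.mulVec, dotProduct, period, Finset.sum_mul, mul_assoc]

theorem period_add (k l : Fin n → ℤ) : period (k + l) = period k + period l := by
  funext j; simp [period, add_mul]

theorem period_neg (k : Fin n → ℤ) : period (-k) = -period k := by
  funext j; simp [period]

/-- The number of cosets of the lattice spanned by the columns of an integer matrix. -/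
theorem natCard_quotient_range_mulVec (ℓ : Matrix (Fin n) (Fin n) ℤ) (hℓ : ℓ.det ≠ 0) :
    Nat.card ((Fin n → ℤ) ⧸ (LinearMap.range ℓ.mulVecLin)) = ℓ.det.natAbs := by
  have hinj : Function.Injective ℓ.mulVecLin := by
    rw [← LinearMap.ker_eq_bot, LinearMap.ker_eq_bot']
    exact fun v hv => Matrix.eq_zero_of_mulVec_eq_zero hℓ hv
  rw [← Submodule.natAbs_det_equiv _ (LinearEquiv.ofInjective _ hinj)]
  congr 1
  rw [← LinearMap.det_toLin']
  rfl

theorem finite_quotient_range_mulVec (ℓ : Matrix (Fin n) (Fin n) ℤ) (hℓ : ℓ.det ≠ 0) :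
    Finite ((Fin n → ℤ) ⧸ (LinearMap.range ℓ.mulVecLin)) :=
  Nat.finite_of_card_ne_zero (by rw [natCard_quotient_range_mulVec ℓ hℓ]; simpa using hℓ)

/-- The preimage under a monomial map of the image in the torus of a connected set `C` has one
component for each coset of `ℤ^n` modulo the rows of the matrix, provided that no translate of `C`
by a non-zero period meets a compact set `D` containing `C`. The set `D` makes the finitely many
pieces relatively closed. -/
theorem card_connectedComponents_preimage_monomialMap {ℓ : Matrix (Fin n) (Fin n) ℤ}
    (hℓ : ℓ.det ≠ 0) (b : Fin n → Circle) {C D : Set (Fin n → ℝ)} (hC : IsConnected C)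
    (hD : IsCompact D) (hCD : C ⊆ D)
    (hsep : ∀ x ∈ C, ∀ y ∈ D, ∀ k, x = y + period k → k = 0) :
    ENat.card (ConnectedComponents (monomialMap ℓ b ⁻¹' (torusExp '' C) : Set (Fin n → Circle))) =
      (ℓ.det.natAbs : ℕ) := by
  obtain ⟨γ, rfl⟩ := torusExp_surjective b
  set A : Matrix (Fin n) (Fin n) ℝ := (ℓ.map (Int.cast : ℤ → ℝ))ᵀ with hA
  have hAdet : IsUnit A.det := by
    rw [hA, Matrix.det_transpose, isUnit_iff_ne_zero]
    have : (ℓ.map (Int.cast : ℤ → ℝ)).det = (ℓ.det : ℝ) :=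
      (RingHom.map_det (Int.castRingHom ℝ) ℓ).symm
    rw [this]; exact_mod_cast hℓ
  have hℓT : ℓᵀ.det ≠ 0 := by rwa [Matrix.det_transpose]
  have hperiod : ∀ k, A *ᵥ period k = period (ℓᵀ *ᵥ k) := fun k => by
    rw [← mulVec_period, hA, Matrix.transpose_map]
  have hAinv : ∀ y, A *ᵥ (A⁻¹ *ᵥ y) = y := fun y => by
    rw [Matrix.mulVec_mulVec, Matrix.mul_nonsing_inv _ hAdet, Matrix.one_mulVec]
  have hinvA : ∀ y, A⁻¹ *ᵥ (A *ᵥ y) = y := fun y => by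
    rw [Matrix.mulVec_mulVec, Matrix.nonsing_inv_mul _ hAdet, Matrix.one_mulVec]
  let N := LinearMap.range ℓᵀ.mulVecLin
  have : Finite ((Fin n → ℤ) ⧸ N) := finite_quotient_range_mulVec _ hℓT
  -- the region attached to a coset is the image in the torus of a copy of `C`
  let g : ((Fin n → ℤ) ⧸ N) → (Fin n → ℝ) → (Fin n → Circle) := fun q x =>
    torusExp (A⁻¹ *ᵥ (x + period (Quotient.out q) - γ))
  have hg : ∀ q, Continuous (g q) := fun q => continuous_torusExp.comp (by fun_prop)
  have hgval : ∀ q x, monomialMap ℓ (torusExp γ) (g q x) = torusExp x := fun q x => by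
    rw [monomialMap_torusExp, ← hA, hAinv, torusExp_eq_iff]
    exact ⟨Quotient.out q, by abel⟩
  have hgsep : ∀ q q' : (Fin n → ℤ) ⧸ N, ∀ x ∈ C, ∀ y ∈ D, g q x = g q' y → q = q' ∧ x = y := by
    intro q q' x hx y hy h
    obtain ⟨m, hm⟩ := torusExp_eq_iff.1 h
    have h1 := congrArg (fun v => A *ᵥ v) hm
    simp only [Matrix.mulVec_add, hAinv, hperiod] at h1
    have h2 : x = y + period (Quotient.out q' - Quotient.out q + ℓᵀ *ᵥ m) := by
      rw [period_add, sub_eq_add_neg, period_add, period_neg]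
      linear_combination h1
    have h3 := hsep x hx y hy _ h2
    refine ⟨?_, by rw [h2, h3]; funext j; simp [period]⟩
    rw [← Quotient.out_eq q, ← Quotient.out_eq q']
    refine (Submodule.Quotient.eq N).2 ⟨m, ?_⟩
    rw [Matrix.mulVecLin_apply]
    linear_combination h3
  have hcard : ENat.card ((Fin n → ℤ) ⧸ N) = (ℓ.det.natAbs : ℕ) := by
    rw [ENat.card_eq_coe_natCard, natCard_quotient_range_mulVec _ hℓT, Matrix.det_transpose]
  rw [← hcard]
  refine card_connectedComponents_subset_of_isClosed (R := fun q => g q '' C)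
    (F := fun q => g q '' D) (fun q => (hD.image (hg q)).isClosed) (fun q => ?_)
    (fun q => hC.image _ (hg q).continuousOn) (fun q q' hqq' => ?_) ?_
  · ext u
    constructor
    · rintro ⟨x, hx, rfl⟩
      exact ⟨⟨x, hx, (hgval q x).symm⟩, x, hCD hx, rfl⟩
    · rintro ⟨⟨x, hx, hxu⟩, y, hy, rfl⟩
      rw [hgval] at hxu
      obtain ⟨k, hk⟩ := torusExp_eq_iff.1 hxu
      have hk0 := hsep x hx y hy k hk
      have : x = y := by rw [hk, hk0]; funext j; simp [period]
      exact ⟨x, hx, by rw [this]⟩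
  · rw [Set.disjoint_left]
    rintro _ ⟨x, hx, rfl⟩ ⟨y, hy, h⟩
    exact hqq' (hgsep q q' x hx y (hCD hy) h.symm).1
  · intro u hu
    obtain ⟨x, rfl⟩ := torusExp_surjective u
    obtain ⟨c, hc, hcx⟩ := hu
    rw [monomialMap_torusExp, ← hA] at hcx
    obtain ⟨k, hk⟩ := torusExp_eq_iff.1 hcx.symm
    refine Set.mem_iUnion.2 ⟨Submodule.Quotient.mk k, c, hc, ?_⟩
    obtain ⟨m, hm⟩ := (Submodule.Quotient.eq N).1
      (Quotient.out_eq (Submodule.Quotient.mk k : (Fin n → ℤ) ⧸ N))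
    rw [Matrix.mulVecLin_apply] at hm
    refine torusExp_eq_iff.2 ⟨m, ?_⟩
    rw [← hinvA x, ← hinvA (period m), ← Matrix.mulVec_add, hperiod, hm,
      sub_eq_add_neg (Quotient.out _) k, period_add, period_neg]
    congr 1
    linear_combination -hk

/-! ### Theorems of the alternative -/

section Alternative

variable {ι E : Type*} [AddCommGroup E] [Module ℝ E]

/-- A linear form that vanishes on the kernel of a linear map factors through that map. -/
theorem exists_dual_of_vanishing_on_ker (Φ : (ι → ℝ) →ₗ[ℝ] E) (f : (ι → ℝ) →ₗ[ℝ] ℝ)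
    (hf : ∀ x, Φ x = 0 → f x = 0) : ∃ g : E →ₗ[ℝ] ℝ, ∀ x, g (Φ x) = f x := by
  have : f ∈ (LinearMap.ker Φ).dualAnnihilator :=
    (Submodule.mem_dualAnnihilator f).2 fun x hx => hf x hx
  rw [← LinearMap.range_dualMap_eq_dualAnnihilator_ker] at this
  obtain ⟨g, rfl⟩ := this
  exact ⟨g, fun x => rfl⟩

theorem eq_zero_of_bddBelow_on_submodule {V : Type*} [AddCommGroup V] [Module ℝ V]
    (N : Submodule ℝ V) (f : V →ₗ[ℝ] ℝ) (a : ℝ) (h : ∀ x ∈ N, a ≤ f x) : ∀ x ∈ N, f x = 0 := by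
  intro x hx
  by_contra hne
  have := h (((a - 1) / f x) • x) (N.smul_mem _ hx)
  rw [map_smul, smul_eq_mul, div_mul_cancel₀ _ hne] at this
  linarith

/-- Stiemke's theorem: vectors without a linear relation with positive coefficients lie in a closed
half-space, not all of them on its boundary. The kernel of `w ↦ ∑ k, w k • v k` is separated from
the open positive orthant. -/
theorem stiemke [Fintype ι] [Nonempty ι] (v : ι → E)
    (h : ¬ ∃ w : ι → ℝ, (∀ k, 0 < w k) ∧ ∑ k, w k • v k = 0) :
    ∃ g : E →ₗ[ℝ] ℝ, (∀ k, 0 ≤ g (v k)) ∧ ∃ k, 0 < g (v k) := by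
  classical
  set Φ := Fintype.linearCombination ℝ v
  set O : Set (ι → ℝ) := Set.pi Set.univ fun _ => Set.Ioi 0
  have hO : ∀ x, x ∈ O ↔ ∀ k, 0 < x k := fun x => by simp [O]
  obtain ⟨f, a, hfO, hfK⟩ := geometric_hahn_banach_open (s := O)
    (t := (LinearMap.ker Φ : Set (ι → ℝ)))
    (convex_pi fun _ _ => convex_Ioi 0) (isOpen_set_pi Set.finite_univ fun _ _ => isOpen_Ioi)
    (LinearMap.ker Φ).convex (by
      rw [Set.disjoint_left]
      intro w hw hk
      exact h ⟨w, (hO w).1 hw, hk⟩)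
  have hker := eq_zero_of_bddBelow_on_submodule (LinearMap.ker Φ) (f : (ι → ℝ) →ₗ[ℝ] ℝ) a hfK
  have ha : a ≤ 0 := by simpa using hfK 0 (zero_mem _)
  obtain ⟨g, hg⟩ := exists_dual_of_vanishing_on_ker Φ (f : (ι → ℝ) →ₗ[ℝ] ℝ) fun x hx => hker x hx
  have hgv : ∀ k, g (v k) = f (Pi.single k 1) := fun k => by
    have := hg (Pi.single k 1)
    simpa [Φ, Fintype.linearCombination_apply_single] using this
  have hneg : ∀ x ∈ O, f x < 0 := fun x hx => (hfO x hx).trans_le ha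
  have hle : ∀ k, g (v k) ≤ 0 := by
    intro k
    rw [hgv]
    -- approach the vertex `e_k` by positive vectors
    have hlim : Filter.Tendsto (fun ε : ℝ => f (Pi.single k 1 + ε • fun _ => (1 : ℝ)))
        (nhdsWithin 0 (Set.Ioi 0)) (nhds (f (Pi.single k 1))) := by
      have hc : Continuous fun ε : ℝ => f (Pi.single k 1 + ε • fun _ => (1 : ℝ)) := by fun_prop
      simpa using (hc.tendsto 0).mono_left nhdsWithin_le_nhds
    refine le_of_tendsto hlim ?_
    filter_upwards [self_mem_nhdsWithin] with ε hε
    refine (hneg _ ((hO _).2 fun j => ?_)).le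
    have : (0 : ℝ) ≤ Pi.single (M := fun _ => ℝ) k (1 : ℝ) j := by
      by_cases hj : j = k
      · subst hj; simp
      · simp [hj]
    have hε' : (0 : ℝ) < ε := hε
    simp only [Pi.add_apply, Pi.smul_apply, smul_eq_mul, mul_one]
    linarith
  refine ⟨-g, fun k => by simpa using hle k, ?_⟩
  by_contra! hall
  have h1 : f (fun _ => 1) < 0 := hneg _ ((hO _).2 fun _ => one_pos)
  have h2 : f (fun _ => 1) = ∑ k, g (v k) := by
    have : f (fun _ => 1) = g (Φ fun _ => 1) := (hg _).symm
    rw [this]; simp [Φ, Fintype.linearCombination_apply]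
  have h3 : 0 ≤ ∑ k, g (v k) := Finset.sum_nonneg fun k _ => by simpa using hall k
  linarith

/-- Gordan's theorem: vectors without a nontrivial linear relation with nonnegative coefficients
lie in an open half-space. -/
theorem gordan [Fintype ι] (v : ι → E)
    (h : ¬ ∃ w : ι → ℝ, (∀ k, 0 ≤ w k) ∧ (∃ k, 0 < w k) ∧ ∑ k, w k • v k = 0) :
    ∃ g : E →ₗ[ℝ] ℝ, ∀ k, 0 < g (v k) := by
  classical
  set Φ := Fintype.linearCombination ℝ v
  obtain ⟨f, a, b, hfS, hab, hfK⟩ := geometric_hahn_banach_compact_closed (s := stdSimplex ℝ ι)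
    (t := (LinearMap.ker Φ : Set (ι → ℝ)))
    (convex_stdSimplex ℝ ι) (isCompact_stdSimplex ℝ ι) (LinearMap.ker Φ).convex
    (Submodule.closed_of_finiteDimensional _) (by
      rw [Set.disjoint_left]
      intro w hw hk
      refine h ⟨w, hw.1, ?_, hk⟩
      by_contra! hall
      have := Finset.sum_nonpos fun k (_ : k ∈ Finset.univ) => hall k
      linarith [hw.2])
  have hker := eq_zero_of_bddBelow_on_submodule (LinearMap.ker Φ) (f : (ι → ℝ) →ₗ[ℝ] ℝ) b
    fun x hx => (hfK x hx).le
  have hb : b < 0 := by simpa using hfK 0 (zero_mem _)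
  obtain ⟨g, hg⟩ := exists_dual_of_vanishing_on_ker Φ (f : (ι → ℝ) →ₗ[ℝ] ℝ) fun x hx => hker x hx
  refine ⟨-g, fun k => ?_⟩
  have h1 : g (v k) = f (Pi.single k 1) := by
    simpa [Φ, Fintype.linearCombination_apply_single] using hg (Pi.single k 1)
  have h2 := hfS _ (single_mem_stdSimplex ℝ k)
  simp only [LinearMap.neg_apply]
  linarith

end Alternative

/-! ### Arguments of complex numbers -/

theorem coe_argC (z : ℂˣ) : ((argC z : Circle) : ℂ) * ‖(z : ℂ)‖ = z := by
  rw [argC, Circle.coe_exp, mul_comm]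
  exact Complex.norm_mul_exp_arg_mul_I _

theorem argC_eq_of_pos {z : ℂˣ} {u : Circle} {r : ℝ} (hr : 0 < r) (h : (z : ℂ) = r * u) :
    argC z = u := by
  rw [argC, h, Complex.arg_real_mul _ hr]
  exact Circle.exp_arg u

theorem argC_mul (z w : ℂˣ) : argC (z * w) = argC z * argC w := by
  refine argC_eq_of_pos (r := ‖(z : ℂ)‖ * ‖(w : ℂ)‖)
    (mul_pos (norm_pos_iff.2 z.ne_zero) (norm_pos_iff.2 w.ne_zero)) ?_
  calc ((z * w : ℂˣ) : ℂ) = (argC z * ‖(z : ℂ)‖) * (argC w * ‖(w : ℂ)‖) := by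
        rw [coe_argC, coe_argC, Units.val_mul]
    _ = _ := by push_cast; ring

/-! ### Relations between points of the circle -/

/-- The points `u` of the real torus such that `1, u_1, ..., u_n` admit a linear relation with
positive coefficients. -/
def posRelation (n : ℕ) : Set (Fin n → Circle) :=
  {u | ∃ w : Fin (n + 1) → ℝ, (∀ k, 0 < w k) ∧
    ∑ k, w k • ((Fin.cons 1 u : Fin (n + 1) → Circle) k : ℂ) = 0}

/-- The points `u` of the real torus such that `0` is in the convex hull of
`1, u_1, ..., u_n`. -/
def nonnegRelation (n : ℕ) : Set (Fin n → Circle) :=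
  {u | ∃ w : Fin (n + 1) → ℝ, (∀ k, 0 ≤ w k) ∧ (∃ k, 0 < w k) ∧
    ∑ k, w k • ((Fin.cons 1 u : Fin (n + 1) → Circle) k : ℂ) = 0}

/-- The differences `η_j - η_0`, which are arguments of the `e^{iη_j}` after a rotation that
brings `e^{iη_0}` to `1`. -/
def phaseDiff : (Fin (n + 1) → ℝ) →ₗ[ℝ] (Fin n → ℝ) where
  toFun η j := η j.succ - η 0
  map_add' x y := by funext j; simp; ring
  map_smul' c x := by funext j; simp; ring

theorem phaseDiff_apply (η : Fin (n + 1) → ℝ) (j : Fin n) : phaseDiff η j = η j.succ - η 0 := rfl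

theorem phaseDiff_surjective : Function.Surjective (phaseDiff (n := n)) := fun x =>
  ⟨Fin.cons 0 x, by funext j; simp [phaseDiff_apply]⟩

/-- Phases in the closed right half-plane. -/
def closedBox (n : ℕ) : Set (Fin (n + 1) → ℝ) := {η | ∀ k, |η k| ≤ Real.pi / 2}

/-- Phases in the open right half-plane. -/
def openBox (n : ℕ) : Set (Fin (n + 1) → ℝ) := {η | ∀ k, |η k| < Real.pi / 2}

/-- Phases in the closed right half-plane, not all of them on its boundary. -/
def halfBox (n : ℕ) : Set (Fin (n + 1) → ℝ) :=
  {η | (∀ k, |η k| ≤ Real.pi / 2) ∧ ∃ k, |η k| < Real.pi / 2}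

theorem cons_torusExp_phaseDiff (η : Fin (n + 1) → ℝ) (k : Fin (n + 1)) :
    (Fin.cons 1 (torusExp (phaseDiff η)) : Fin (n + 1) → Circle) k * Circle.exp (η 0) =
      Circle.exp (η k) := by
  refine Fin.cases ?_ (fun j => ?_) k
  · simp
  · simp [torusExp, phaseDiff_apply]

theorem sum_mul_cos_eq_zero {η : Fin (n + 1) → ℝ} {w : Fin (n + 1) → ℝ}
    (h : ∑ k, w k • ((Fin.cons 1 (torusExp (phaseDiff η)) : Fin (n + 1) → Circle) k : ℂ) = 0) :
    ∑ k, w k * Real.cos (η k) = 0 := by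
  have h1 := congrArg (fun z : ℂ => (z * (Circle.exp (η 0) : ℂ)).re) h
  simp only [Finset.sum_mul, Complex.re_sum, zero_mul, Complex.zero_re] at h1
  rw [← h1]
  refine Finset.sum_congr rfl fun k _ => ?_
  rw [smul_mul_assoc, ← Circle.coe_mul, cons_torusExp_phaseDiff, Complex.real_smul,
    Complex.re_ofReal_mul, Circle.coe_exp, Complex.exp_ofReal_mul_I_re]

/-- Phases of the points `1, u_1, ..., u_n` relative to the axis of a half-plane `g ≥ 0`. A linear
form on `ℂ` is `z ↦ Re (z w)` for some `w`, so the phases are the arguments of the `u_k w`. -/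
theorem exists_phases {u : Fin n → Circle} (g : ℂ →ₗ[ℝ] ℝ)
    (hg : ∃ k, 0 < g ((Fin.cons 1 u : Fin (n + 1) → Circle) k)) :
    ∃ η : Fin (n + 1) → ℝ, torusExp (phaseDiff η) = u ∧ ∀ k,
      (0 ≤ g ((Fin.cons 1 u : Fin (n + 1) → Circle) k) → |η k| ≤ Real.pi / 2) ∧
      (0 < g ((Fin.cons 1 u : Fin (n + 1) → Circle) k) → |η k| < Real.pi / 2) := by
  have hgz : ∀ z : ℂ, g z = (z * (g 1 - g Complex.I * Complex.I)).re := fun z => by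
    conv_lhs => rw [← Complex.re_add_im z, ← mul_one (z.re : ℂ), ← Complex.real_smul,
      ← Complex.real_smul, map_add, map_smul, map_smul]
    simp
  have hw : (g 1 - g Complex.I * Complex.I : ℂ) ≠ 0 := by
    intro h0
    obtain ⟨k, hk⟩ := hg
    rw [hgz, h0] at hk
    simp at hk
  set w : ℂˣ := Units.mk0 _ hw with hwdef
  refine ⟨fun k => (((Circle.toUnits ((Fin.cons 1 u : Fin (n + 1) → Circle) k) * w : ℂˣ) : ℂ)).arg,
    ?_, fun k => ⟨fun h => ?_, fun h => ?_⟩⟩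
  · have hc : ∀ c : Circle, argC (Circle.toUnits c * w) = c * argC w := fun c => by
      rw [argC_mul, argC_eq_of_pos (u := c) one_pos (by simp)]
    funext j
    change Circle.exp (_ - _) = _
    rw [Circle.exp_sub]
    change argC _ / argC _ = _
    rw [hc, hc]
    simp
  · rw [Complex.abs_arg_le_pi_div_two_iff]
    rw [hgz] at h
    simpa [hwdef] using h
  · rw [Complex.abs_arg_lt_pi_div_two_iff]
    rw [hgz] at h
    left
    simpa [hwdef] using h

theorem compl_posRelation :
    (posRelation n)ᶜ = torusExp '' (phaseDiff '' halfBox n) := by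
  ext u
  constructor
  · intro hu
    obtain ⟨g, hg0, k, hk⟩ := stiemke (fun k => ((Fin.cons 1 u : Fin (n + 1) → Circle) k : ℂ)) hu
    obtain ⟨η, hη, h⟩ := exists_phases g ⟨k, hk⟩
    exact ⟨_, ⟨η, ⟨fun k => (h k).1 (hg0 k), k, (h k).2 hk⟩, rfl⟩, hη⟩
  · rintro ⟨_, ⟨η, ⟨hη, k, hk⟩, rfl⟩, rfl⟩ ⟨w, hw, hsum⟩
    have hpos : 0 < ∑ k, w k * Real.cos (η k) := Finset.sum_pos'
      (fun j _ => mul_nonneg (hw j).le (Real.cos_nonneg_of_mem_Icc (abs_le.1 (hη j))))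
      ⟨k, Finset.mem_univ k, mul_pos (hw k) (Real.cos_pos_of_mem_Ioo (abs_lt.1 hk))⟩
    exact hpos.ne' (sum_mul_cos_eq_zero hsum)

theorem compl_nonnegRelation :
    (nonnegRelation n)ᶜ = torusExp '' (phaseDiff '' openBox n) := by
  ext u
  constructor
  · intro hu
    obtain ⟨g, hg⟩ := gordan (fun k => ((Fin.cons 1 u : Fin (n + 1) → Circle) k : ℂ)) hu
    obtain ⟨η, hη, h⟩ := exists_phases g ⟨0, hg 0⟩
    exact ⟨_, ⟨η, fun k => (h k).2 (hg k), rfl⟩, hη⟩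
  · rintro ⟨_, ⟨η, hη, rfl⟩, rfl⟩ ⟨w, hw, ⟨k, hk⟩, hsum⟩
    have hcos : ∀ j, 0 < Real.cos (η j) := fun j => Real.cos_pos_of_mem_Ioo (abs_lt.1 (hη j))
    have hpos : 0 < ∑ k, w k * Real.cos (η k) := Finset.sum_pos'
      (fun j _ => mul_nonneg (hw j) (hcos j).le) ⟨k, Finset.mem_univ k, mul_pos hk (hcos k)⟩
    exact hpos.ne' (sum_mul_cos_eq_zero hsum)

theorem openBox_subset_halfBox : openBox n ⊆ halfBox n := fun _ h => ⟨fun k => (h k).le, 0, h 0⟩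

theorem isConnected_image_of_smul_mem {V W : Type*} [AddCommGroup V] [Module ℝ V]
    [TopologicalSpace V] [IsTopologicalAddGroup V] [ContinuousSMul ℝ V] [TopologicalSpace W]
    {B : Set V} (h0 : (0 : V) ∈ B) (hB : ∀ x ∈ B, ∀ t : ℝ, 0 ≤ t → t ≤ 1 → t • x ∈ B) {f : V → W}
    (hf : Continuous f) : IsConnected (f '' B) := by
  have hstar : StarConvex ℝ 0 B := by
    rw [starConvex_zero_iff]
    exact fun x hx t h0 h1 => hB x hx t h0 h1
  exact (hstar.isPathConnected h0).isConnected.image f hf.continuousOn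

theorem continuous_phaseDiff : Continuous (phaseDiff (n := n)) :=
  LinearMap.continuous_of_finiteDimensional _

theorem isConnected_phaseDiff_halfBox : IsConnected (phaseDiff '' halfBox n) := by
  have hpi := Real.pi_pos
  refine isConnected_image_of_smul_mem (B := halfBox n)
    ⟨fun k => by simp; positivity, 0, by simp; positivity⟩ ?_ continuous_phaseDiff
  rintro η ⟨hη, k, hk⟩ t h0 h1
  have hle : ∀ j, |(t • η) j| ≤ |η j| := fun j => by
    rw [Pi.smul_apply, smul_eq_mul, abs_mul, abs_of_nonneg h0]
    exact mul_le_of_le_one_left (abs_nonneg _) h1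
  exact ⟨fun j => (hle j).trans (hη j), k, (hle k).trans_lt hk⟩

theorem isConnected_phaseDiff_openBox : IsConnected (phaseDiff '' openBox n) := by
  have hpi := Real.pi_pos
  refine isConnected_image_of_smul_mem (B := openBox n) (fun k => by simp; positivity) ?_
    continuous_phaseDiff
  intro η hη t h0 h1 j
  refine lt_of_le_of_lt ?_ (hη j)
  rw [Pi.smul_apply, smul_eq_mul, abs_mul, abs_of_nonneg h0]
  exact mul_le_of_le_one_left (abs_nonneg _) h1

theorem isCompact_phaseDiff_closedBox : IsCompact (phaseDiff '' closedBox n) := by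
  refine IsCompact.image ?_ continuous_phaseDiff
  have : closedBox n = Set.pi Set.univ fun _ => Set.Icc (-(Real.pi / 2)) (Real.pi / 2) := by
    ext η; simp [closedBox, abs_le, Pi.le_def, forall_and]
  rw [this]
  exact isCompact_univ_pi fun _ => isCompact_Icc

/-- The translates by distinct periods of the set of phase differences of `halfBox` are disjoint,
even after one of them is replaced by its closure. A coordinate with a non-zero period would have
`x_j` and `x_0` at opposite ends of `[-π/2, π/2]`, and then all the phases would be at the ends,
which `halfBox` excludes. -/
theorem period_eq_zero_of_phaseDiff {η κ : Fin (n + 1) → ℝ} (hη : η ∈ halfBox n)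
    (hκ : κ ∈ closedBox n) {k : Fin n → ℤ} (h : phaseDiff η = phaseDiff κ + period k) :
    k = 0 := by
  have hpi := Real.pi_pos
  obtain ⟨hη, i, hi⟩ := hη
  have hd : ∀ j : Fin n, η j.succ - η 0 = κ j.succ - κ 0 + k j * (2 * Real.pi) := fun j =>
    congrFun h j
  have hη' := fun j => abs_le.1 (hη j)
  have hκ' := fun j => abs_le.1 (hκ j)
  by_contra hk
  obtain ⟨j, hj⟩ := Function.ne_iff.1 hk
  have hη0 := hη' 0
  have hκ0 := hκ' 0
  have hηj := hη' j.succ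
  have hκj := hκ' j.succ
  have hdj := hd j
  -- a non-zero period forces `η 0` to one end of the interval and `κ 0` to the other one
  rcases lt_or_gt_of_ne hj with hneg | hpos
  · have h1 : (k j : ℝ) ≤ -1 := by exact_mod_cast Int.le_sub_one_of_lt hneg
    have h0 : η 0 = Real.pi / 2 := by nlinarith
    have h0' : κ 0 = -(Real.pi / 2) := by nlinarith
    refine absurd hi (not_lt.2 ?_)
    refine Fin.cases ?_ (fun l => ?_) i
    · rw [h0]; exact le_abs_self _
    · have hdl := hd l
      have hηl := hη' l.succ
      have hκl := hκ' l.succ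
      rcases le_or_gt 0 (k l) with hkl | hkl
      · have : (0 : ℝ) ≤ k l := by exact_mod_cast hkl
        exact le_abs.2 (Or.inl (by nlinarith))
      · have : (k l : ℝ) ≤ -1 := by exact_mod_cast Int.le_sub_one_of_lt hkl
        exact le_abs.2 (Or.inr (by nlinarith))
  · have h1 : (1 : ℝ) ≤ k j := by exact_mod_cast hpos
    have h0 : η 0 = -(Real.pi / 2) := by nlinarith
    have h0' : κ 0 = Real.pi / 2 := by nlinarith
    refine absurd hi (not_lt.2 ?_)
    refine Fin.cases ?_ (fun l => ?_) i
    · rw [h0, abs_neg]; exact le_abs_self _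
    · have hdl := hd l
      have hηl := hη' l.succ
      have hκl := hκ' l.succ
      rcases le_or_gt (k l) 0 with hkl | hkl
      · have : (k l : ℝ) ≤ 0 := by exact_mod_cast hkl
        exact le_abs.2 (Or.inr (by nlinarith))
      · have : (1 : ℝ) ≤ k l := by exact_mod_cast hkl
        exact le_abs.2 (Or.inl (by nlinarith))

theorem isClosed_nonnegRelation : IsClosed (nonnegRelation n) := by
  rw [← isOpen_compl_iff, compl_nonnegRelation]
  refine isOpenMap_torusExp _ (LinearMap.isOpenMap_of_finiteDimensional _ phaseDiff_surjective _ ?_)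
  have : openBox n = Set.pi Set.univ fun _ => Set.Ioo (-(Real.pi / 2)) (Real.pi / 2) := by
    ext η; simp [openBox, abs_lt]
  rw [this]
  exact isOpen_set_pi Set.finite_univ fun _ _ => isOpen_Ioo

theorem posRelation_of_sum_eq_zero {c : Fin (n + 1) → Circle} {w : Fin (n + 1) → ℝ}
    (hw : ∀ k, 0 < w k) (h : ∑ k, w k • (c k : ℂ) = 0) :
    (fun j : Fin n => c j.succ / c 0) ∈ posRelation n := by
  refine ⟨w, hw, ?_⟩
  have h1 : ∀ k, (Fin.cons 1 (fun j : Fin n => c j.succ / c 0) : Fin (n + 1) → Circle) k =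
      c k / c 0 := fun k => Fin.cases (by simp) (fun j => by simp) k
  have h2 : ∀ k, w k • ((c k / c 0 : Circle) : ℂ) = (w k • (c k : ℂ)) * (c 0 : ℂ)⁻¹ := fun k => by
    rw [Circle.coe_div, div_eq_mul_inv, smul_mul_assoc]
  simp only [h1, h2, ← Finset.sum_mul, h, zero_mul]

/-- A nonnegative relation is a limit of positive ones: the points whose weight vanishes get a small
weight, at the price of a small rotation of one point of positive weight. -/
theorem closure_posRelation : closure (posRelation n) = nonnegRelation n := by
  refine subset_antisymm (closure_minimal ?_ isClosed_nonnegRelation) ?_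
  · rintro u ⟨w, hw, h⟩
    exact ⟨w, fun k => (hw k).le, ⟨0, hw 0⟩, h⟩
  rintro u ⟨w, hw, ⟨i, hi⟩, hsum⟩
  set v : Fin (n + 1) → Circle := Fin.cons 1 u with hv
  -- replace the vanishing weights by `ε` and compensate in the `i`-th term
  let e : Fin (n + 1) → ℝ := fun k => if w k = 0 then 1 else 0
  let τ : ℂ := (∑ k, e k • (v k : ℂ)) / (w i * v i)
  have hτ : (w i : ℂ) * v i * τ = ∑ k, e k • (v k : ℂ) :=
    mul_div_cancel₀ _ (mul_ne_zero (by exact_mod_cast hi.ne') (Circle.coe_ne_zero _))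
  let ρ : ℝ → ℂ := fun ε => 1 - ε * τ
  let c : ℝ → Fin (n + 1) → Circle := fun ε k =>
    v k * if k = i then Circle.exp (ρ ε).arg else 1
  let w' : ℝ → Fin (n + 1) → ℝ := fun ε k => (w k + ε * e k) * if k = i then ‖ρ ε‖ else 1
  have hei : e i = 0 := if_neg hi.ne'
  have hρ : Continuous ρ := by fun_prop
  have hρ0 : ρ 0 = 1 := by simp [ρ]
  have hterm : ∀ ε k, w' ε k • (c ε k : ℂ) =
      w k • (v k : ℂ) + (ε : ℂ) * (e k • (v k : ℂ)) -
        if k = i then (ε : ℂ) * ((w i : ℂ) * v i * τ) else 0 := by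
    intro ε k
    by_cases hk : k = i
    · subst hk
      have := Complex.norm_mul_exp_arg_mul_I (ρ ε)
      simp only [w', c, hei, if_true, Circle.coe_mul, Circle.coe_exp, Complex.real_smul]
      push_cast
      rw [show ((w k : ℂ) + ε * 0) * ‖ρ ε‖ * (v k * Complex.exp ((ρ ε).arg * Complex.I)) =
        w k * v k * (‖ρ ε‖ * Complex.exp ((ρ ε).arg * Complex.I)) by ring, this]
      simp only [ρ]
      ring
    · simp only [w', c, if_neg hk, Complex.real_smul]
      push_cast
      ring
  have hmem : ∀ᶠ ε in nhdsWithin (0 : ℝ) (Set.Ioi 0),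
      (fun j : Fin n => c ε j.succ / c ε 0) ∈ posRelation n := by
    have hne : ∀ᶠ ε in nhdsWithin (0 : ℝ) (Set.Ioi 0), ρ ε ≠ 0 :=
      (hρ.continuousAt.eventually_ne (by simp [hρ0])).filter_mono nhdsWithin_le_nhds
    filter_upwards [hne, self_mem_nhdsWithin] with ε hε hpos
    have hpos : (0 : ℝ) < ε := hpos
    refine posRelation_of_sum_eq_zero (w := w' ε) (fun k => mul_pos ?_ ?_) ?_
    · by_cases hk : w k = 0
      · simp [e, hk, hpos]
      · simpa [e, hk] using lt_of_le_of_ne (hw k) (Ne.symm hk)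
    · split_ifs
      · exact norm_pos_iff.2 hε
      · exact one_pos
    · simp only [hterm, Finset.sum_sub_distrib, Finset.sum_add_distrib, hsum, ← Finset.mul_sum,
        Finset.sum_ite_eq', Finset.mem_univ, if_true, hτ]
      ring
  refine mem_closure_of_tendsto (b := nhdsWithin (0 : ℝ) (Set.Ioi 0))
    (f := fun ε => fun j : Fin n => c ε j.succ / c ε 0) ?_ hmem
  have hc : ∀ k, ContinuousAt (fun ε => c ε k) 0 := by
    intro k
    refine continuousAt_const.mul ?_
    by_cases hk : k = i
    · simp only [hk, if_true]
      refine Circle.exp.continuous.continuousAt.comp ?_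
      refine ContinuousAt.comp (g := Complex.arg) ?_ hρ.continuousAt
      rw [hρ0]
      exact Complex.continuousAt_arg Complex.one_mem_slitPlane
    · simp only [if_neg hk]
      exact continuousAt_const
  have hc0 : ∀ k, c 0 k = v k := fun k => by simp [c, hρ0]
  have hlim : ContinuousAt (fun ε => fun j : Fin n => c ε j.succ / c ε 0) 0 :=
    continuousAt_pi.2 fun j => (hc j.succ).div' (hc 0)
  have h0 : (fun j : Fin n => c 0 j.succ / c 0 0) = u := by
    funext j; simp [hc0, hv]
  have := hlim.tendsto
  rw [h0] at this
  exact this.mono_left nhdsWithin_le_nhds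

/-! ### Reduction to the standard hyperplane -/

section Reduction

variable {K : Type*} [Field K]

theorem eval_add (f g : LaurentPoly K n) (z : Fin n → Kˣ) :
    eval (f + g) z = eval f z + eval g z := by
  simp only [eval, AddMonoidAlgebra.coeff_add]
  exact Finsupp.sum_add_index' (fun _ => zero_mul _) fun _ _ _ => add_mul _ _ _

theorem eval_single (α : Fin n → ℤ) (c : K) (z : Fin n → Kˣ) :
    eval (AddMonoidAlgebra.single α c) z = c * ((∏ j, z j ^ α j : Kˣ) : K) := by
  simp only [eval, AddMonoidAlgebra.coeff_single]
  exact Finsupp.sum_single_index (zero_mul _)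

theorem eval_zero (z : Fin n → Kˣ) : eval (0 : LaurentPoly K n) z = 0 := by
  simp [eval]

theorem eval_sum {ι : Type*} (s : Finset ι) (f : ι → LaurentPoly K n) (z : Fin n → Kˣ) :
    eval (∑ i ∈ s, f i) z = ∑ i ∈ s, eval (f i) z := by
  classical
  induction s using Finset.induction_on with
  | empty => simp [eval_zero]
  | insert i s hi ih => rw [Finset.sum_insert hi, Finset.sum_insert hi, eval_add, ih]

theorem eval_stdPoly (z : Fin n → Kˣ) : eval (stdPoly K n) z = 1 + ∑ j, (z j : K) := by
  rw [stdPoly, eval_add, eval_single, eval_sum]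
  congr 1
  · simp
  · refine Finset.sum_congr rfl fun j _ => ?_
    rw [eval_single, one_mul, Finset.prod_eq_single j (fun i _ hi => by simp [hi]) (by simp)]
    simp

theorem mem_hypersurface_stdPoly {z : Fin n → Kˣ} :
    z ∈ hypersurface (stdPoly K n) ↔ 1 + ∑ j, (z j : K) = 0 := by
  rw [← eval_stdPoly]; rfl

theorem eval_of_isLabelling {f : LaurentPoly K n} {α : Fin (n + 1) → Fin n → ℤ}
    {c : Fin (n + 1) → Kˣ} (h : IsLabelling f α c) (z : Fin n → Kˣ) :
    eval f z = ∑ k, (c k : K) * ((∏ j, z j ^ α k j : Kˣ) : K) := by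
  classical
  obtain ⟨hinj, hrange, hc⟩ := h
  have hs : f.coeff.support = Finset.univ.image α := by
    ext β
    rw [Finsupp.mem_support_iff, Finset.mem_image]
    exact (Set.ext_iff.1 hrange β).symm.trans (by simp)
  rw [eval, Finsupp.sum, hs, Finset.sum_image fun _ _ _ _ e => hinj e]
  exact Finset.sum_congr rfl fun k _ => by rw [hc]

/-- The integer matrix whose columns are the edges of the simplex at the vertex `α 0`. -/
def edgeMatrix (α : Fin (n + 1) → Fin n → ℤ) : Matrix (Fin n) (Fin n) ℤ :=
  Matrix.of fun j k => α k.succ j - α 0 j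

theorem simplexMatrix_eq_map (α : Fin (n + 1) → Fin n → ℤ) :
    simplexMatrix α = (edgeMatrix α).map (Int.cast : ℤ → ℝ) := rfl

theorem det_simplexMatrix (α : Fin (n + 1) → Fin n → ℤ) :
    (simplexMatrix α).det = ((edgeMatrix α).det : ℝ) :=
  (RingHom.map_det (Int.castRingHom ℝ) (edgeMatrix α)).symm

/-- The hypersurface is the preimage of the standard hyperplane under a monomial map. -/
theorem mem_hypersurface_iff {f : LaurentPoly K n} {α : Fin (n + 1) → Fin n → ℤ}
    {c : Fin (n + 1) → Kˣ} (h : IsLabelling f α c) (z : Fin n → Kˣ) :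
    z ∈ hypersurface f ↔
      monomialMap (edgeMatrix α) (fun k => c k.succ / c 0) z ∈ hypersurface (stdPoly K n) := by
  have key : eval f z = ((c 0 * ∏ j, z j ^ α 0 j : Kˣ) : K) *
      (1 + ∑ k, ((monomialMap (edgeMatrix α) (fun k => c k.succ / c 0) z k : Kˣ) : K)) := by
    rw [eval_of_isLabelling h, Fin.sum_univ_succ, mul_add, mul_one, Finset.mul_sum, Units.val_mul]
    congr 1
    refine Finset.sum_congr rfl fun k _ => ?_
    rw [← Units.val_mul, ← Units.val_mul]
    have : ∏ j, z j ^ edgeMatrix α j k = (∏ j, z j ^ α k.succ j) / ∏ j, z j ^ α 0 j := by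
      rw [← Finset.prod_div_distrib]
      exact Finset.prod_congr rfl fun j _ => by simp [edgeMatrix, zpow_sub, div_eq_mul_inv]
    rw [monomialMap, this, div_mul_div_comm, ← Units.val_mul, mul_div_cancel]
  rw [mem_hypersurface_stdPoly, hypersurface, Set.mem_ofPred_eq, key, mul_eq_zero,
    or_iff_right (Units.ne_zero _)]

/-- Over a divisible group a monomial map is surjective: with `y` a root of order `det ℓ` of the
target, the adjugate matrix of `ℓ` gives the exponents of a preimage. -/
theorem monomialMap_surjective {G : Type*} [CommGroup G]
    (hdiv : ∀ d : ℕ, d ≠ 0 → ∀ x : G, ∃ y, y ^ d = x) {ℓ : Matrix (Fin n) (Fin n) ℤ}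
    (hℓ : ℓ.det ≠ 0) (b : Fin n → G) : Function.Surjective (monomialMap ℓ b) := by
  intro w
  have hroot : ∀ k, ∃ y : G, y ^ ℓ.det = w k / b k := fun k => by
    obtain ⟨y, hy⟩ := hdiv ℓ.det.natAbs (Int.natAbs_ne_zero.2 hℓ) (w k / b k)
    rcases Int.natAbs_eq ℓ.det with h | h
    · exact ⟨y, by rw [h, zpow_natCast, hy]⟩
    · exact ⟨y⁻¹, by rw [h, inv_zpow', neg_neg, zpow_natCast, hy]⟩
  choose y hy using hroot
  refine ⟨fun j => ∏ i, y i ^ ℓ.adjugate i j, funext fun k => ?_⟩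
  have hzpow : ∀ (x : G) (e : Fin n → ℤ), x ^ ∑ j, e j = ∏ j, x ^ e j := fun x e =>
    map_prod (zpowersHom G x) (fun j => Multiplicative.ofAdd (e j)) Finset.univ
  have h1 : ∀ i, ∏ j, (y i ^ ℓ.adjugate i j) ^ ℓ j k = if i = k then w k / b k else 1 := by
    intro i
    have h2 : ∏ j, (y i ^ ℓ.adjugate i j) ^ ℓ j k = y i ^ (ℓ.adjugate * ℓ) i k := by
      rw [Matrix.mul_apply, hzpow]
      exact Finset.prod_congr rfl fun j _ => (zpow_mul _ _ _).symm
    rw [h2, Matrix.adjugate_mul, Matrix.smul_apply, Matrix.one_apply]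
    split_ifs with hik
    · subst hik; simp [hy]
    · simp
  simp only [monomialMap, ← Finset.prod_zpow]
  rw [Finset.prod_comm]
  simp only [h1]
  simp

theorem amoeba_eq_image_pullMap {ν : Kˣ → ℝ} (hν : ∀ x y, ν (x * y) = ν x + ν y)
    (hdiv : ∀ d : ℕ, d ≠ 0 → ∀ x : Kˣ, ∃ y, y ^ d = x) {f : LaurentPoly K n}
    {α : Fin (n + 1) → Fin n → ℤ} {c : Fin (n + 1) → Kˣ} (h : IsLabelling f α c)
    (hdet : (simplexMatrix α).det ≠ 0) :
    amoeba ν f = pullMap (simplexMatrix α) (fun k => ν (c k.succ / c 0)) ''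
      amoeba ν (stdPoly K n) := by
  have hdetZ : (edgeMatrix α).det ≠ 0 := by
    rw [det_simplexMatrix] at hdet; exact_mod_cast hdet
  let N : Kˣ →* Multiplicative ℝ := MonoidHom.mk' (fun x => Multiplicative.ofAdd (ν x)) hν
  have hN : ∀ x, ν x = (N x).toAdd := fun x => rfl
  have hpull : ∀ z : Fin n → Kˣ, pullMap (simplexMatrix α) (fun k => ν (c k.succ / c 0))
      (fun k => ν (monomialMap (edgeMatrix α) (fun k => c k.succ / c 0) z k)) =
      fun j => ν (z j) := by
    intro z
    have h1 : (fun k => ν (monomialMap (edgeMatrix α) (fun k => c k.succ / c 0) z k)) -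
        (fun k => ν (c k.succ / c 0)) = (simplexMatrix α)ᵀ *ᵥ fun j => ν (z j) := by
      funext k
      simp only [Pi.sub_apply, hN, monomialMap, map_mul, map_prod, map_zpow, toAdd_mul, toAdd_prod,
        toAdd_zpow, add_sub_cancel_left, Matrix.mulVec, dotProduct, Matrix.transpose_apply,
        simplexMatrix_eq_map, Matrix.map_apply, zsmul_eq_mul]
    rw [pullMap, h1, Matrix.mulVec_mulVec, Matrix.nonsing_inv_mul _
      (by rw [Matrix.det_transpose]; exact hdet.isUnit), Matrix.one_mulVec]
  ext y
  constructor
  · rintro ⟨z, hz, rfl⟩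
    exact ⟨_, ⟨_, (mem_hypersurface_iff h z).1 hz, rfl⟩, hpull z⟩
  · rintro ⟨_, ⟨w, hw, rfl⟩, rfl⟩
    obtain ⟨z, rfl⟩ := monomialMap_surjective hdiv hdetZ (fun k => c k.succ / c 0) w
    exact ⟨z, (mem_hypersurface_iff h z).2 hw, (hpull z).symm⟩

theorem coamoeba_eq_preimage (θ : Kˣ →* Circle) (s : Circle →* Kˣ) (hs : ∀ u, θ (s u) = u)
    (hdiv : ∀ d : ℕ, d ≠ 0 → ∀ x : Kˣ, ∃ y, y ^ d = x) {f : LaurentPoly K n}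
    {α : Fin (n + 1) → Fin n → ℤ} {c : Fin (n + 1) → Kˣ} (h : IsLabelling f α c)
    (hdet : (edgeMatrix α).det ≠ 0) :
    coamoeba θ f = monomialMap (edgeMatrix α) (fun k => θ (c k.succ / c 0)) ⁻¹'
      coamoeba θ (stdPoly K n) := by
  ext u
  constructor
  · rintro ⟨z, hz, rfl⟩
    exact ⟨_, (mem_hypersurface_iff h z).1 hz, map_monomialMap θ _ _ z⟩
  · rintro ⟨w, hw, hwu⟩
    -- solve `a z ^ L = w` with `z` of argument `u`, writing `z = s(u) y` with `y` in
    -- the kernel of `θ`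
    have hker : ∀ d : ℕ, d ≠ 0 → ∀ x : θ.ker, ∃ y, y ^ d = x := by
      rintro d hd ⟨x, hx⟩
      obtain ⟨y, hy⟩ := hdiv d hd x
      have hxy : θ y ^ d = 1 := by rw [← map_pow, hy]; exact hx
      refine ⟨⟨y / s (θ y), by rw [MonoidHom.mem_ker, map_div, hs, div_self']⟩, Subtype.ext ?_⟩
      simp [div_pow, hy, ← map_pow, hxy]
    let a : Fin n → Kˣ := fun k => c k.succ / c 0
    have hmem : ∀ k, w k / monomialMap (edgeMatrix α) a (fun j => s (u j)) k ∈ θ.ker := by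
      intro k
      have h1 := congrFun (map_monomialMap θ (edgeMatrix α) a fun j => s (u j)) k
      have h2 := congrFun hwu k
      simp only [hs] at h1
      rw [MonoidHom.mem_ker, map_div, h1]
      exact div_eq_one.2 h2
    obtain ⟨y, hy⟩ := monomialMap_surjective hker hdet (fun _ => 1) (fun k => ⟨_, hmem k⟩)
    have hz : monomialMap (edgeMatrix α) a (fun j => s (u j) * y j) = w := by
      funext k
      have h1 := congrArg Subtype.val (congrFun hy k)
      have h2 : (∏ j, (y j : Kˣ) ^ edgeMatrix α j k) =
          w k / monomialMap (edgeMatrix α) a (fun j => s (u j)) k := by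
        refine Eq.trans ?_ h1
        simp [monomialMap]
      have h3 : monomialMap (edgeMatrix α) a (fun j => s (u j) * y j) k =
          monomialMap (edgeMatrix α) a (fun j => s (u j)) k *
            ∏ j, (y j : Kˣ) ^ edgeMatrix α j k := by
        simp only [monomialMap, mul_zpow, Finset.prod_mul_distrib, mul_assoc]
      rw [h3, h2, mul_div_cancel]
    refine ⟨fun j => s (u j) * y j, (mem_hypersurface_iff h _).2 ?_, ?_⟩
    · change monomialMap (edgeMatrix α) a _ ∈ _
      rw [hz]; exact hw
    · funext j
      change θ (s (u j) * y j) = u j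
      rw [map_mul, hs, MonoidHom.mem_ker.1 (y j).2, mul_one]

theorem lift_preimage_monomialMap {α : Fin (n + 1) → Fin n → ℤ}
    (hdet : (simplexMatrix α).det ≠ 0) (γ : Fin n → ℝ) (S : Set (Fin n → Circle)) :
    lift (monomialMap (edgeMatrix α) (torusExp γ) ⁻¹' S) =
      pullMap (simplexMatrix α) γ '' lift S := by
  have hu : IsUnit (simplexMatrix α)ᵀ.det := by rw [Matrix.det_transpose]; exact hdet.isUnit
  have hl : ∀ x, x ∈ lift (monomialMap (edgeMatrix α) (torusExp γ) ⁻¹' S) ↔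
      (simplexMatrix α)ᵀ *ᵥ x + γ ∈ lift S := fun x => by
    change monomialMap _ _ (torusExp x) ∈ S ↔ torusExp _ ∈ S
    rw [monomialMap_torusExp, simplexMatrix_eq_map]
  ext x
  rw [hl]
  constructor
  · intro hx
    refine ⟨_, hx, ?_⟩
    rw [pullMap, add_sub_cancel_right, Matrix.mulVec_mulVec, Matrix.nonsing_inv_mul _ hu,
      Matrix.one_mulVec]
  · rintro ⟨y, hy, rfl⟩
    rwa [pullMap, Matrix.mulVec_mulVec, Matrix.mul_nonsing_inv _ hu, Matrix.one_mulVec,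
      sub_add_cancel]

end Reduction

/-! ### The standard hyperplane over the complex numbers -/

theorem logC_mul (x y : ℂˣ) : logC (x * y) = logC x + logC y := by
  rw [logC, Units.val_mul, norm_mul,
    Real.log_mul (norm_ne_zero_iff.2 x.ne_zero) (norm_ne_zero_iff.2 y.ne_zero)]
  rfl

/-- The argument as a homomorphism. -/
noncomputable def argCHom : ℂˣ →* Circle := MonoidHom.mk' argC argC_mul

theorem argC_toUnits (u : Circle) : argC (Circle.toUnits u) = u :=
  argC_eq_of_pos one_pos (by simp)

theorem exists_pow_eq_complex (d : ℕ) (hd : d ≠ 0) (x : ℂˣ) : ∃ y, y ^ d = x := by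
  obtain ⟨z, hz⟩ := IsAlgClosed.exists_pow_nat_eq (x : ℂ) (Nat.pos_of_ne_zero hd)
  have hz0 : z ≠ 0 := by rintro rfl; exact x.ne_zero (by rw [← hz, zero_pow hd])
  exact ⟨Units.mk0 z hz0, Units.ext (by simp [hz])⟩

theorem coamoeba_stdPoly_complex : coamoeba argC (stdPoly ℂ n) = posRelation n := by
  ext u
  constructor
  · rintro ⟨z, hz, rfl⟩
    rw [mem_hypersurface_stdPoly] at hz
    refine ⟨Fin.cons 1 fun j => ‖(z j : ℂ)‖, fun k => ?_, ?_⟩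
    · refine Fin.cases ?_ (fun j => ?_) k
      · simp
      · simp
    · rw [Fin.sum_univ_succ, ← hz]
      simp only [Fin.cons_zero, Fin.cons_succ, Circle.coe_one, one_smul, Complex.real_smul]
      congr 1
      exact Finset.sum_congr rfl fun j _ => by rw [mul_comm, coe_argC]
  · rintro ⟨w, hw, h⟩
    have hw0 : (w 0 : ℂ) ≠ 0 := by exact_mod_cast (hw 0).ne'
    have hne : ∀ j : Fin n, ((w j.succ / w 0 : ℝ) * (u j : ℂ) : ℂ) ≠ 0 := fun j =>
      mul_ne_zero (by exact_mod_cast (div_pos (hw _) (hw 0)).ne') (Circle.coe_ne_zero _)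
    refine ⟨fun j => Units.mk0 _ (hne j), ?_, ?_⟩
    · rw [mem_hypersurface_stdPoly]
      rw [Fin.sum_univ_succ] at h
      simp only [Fin.cons_zero, Fin.cons_succ, Circle.coe_one, Complex.real_smul, mul_one] at h
      simp only [Units.val_mk0]
      rw [← mul_right_inj' hw0, mul_zero, ← h, mul_add, mul_one, Finset.mul_sum]
      congr 1
      refine Finset.sum_congr rfl fun j _ => ?_
      push_cast
      field_simp
    · funext j
      exact argC_eq_of_pos (div_pos (hw j.succ) (hw 0)) (by simp)

/-- Numbers in `[0, M]` have a signed sum in `[-M, M]`. The signs `cos (θ k) = ±1` are chosen one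
after the other, each opposite to the partial sum. -/
theorem exists_signed_sum_le {ι : Type*} [DecidableEq ι] {r : ι → ℝ} {M : ℝ} (hr : ∀ k, 0 ≤ r k)
    (hM : ∀ k, r k ≤ M) (hM0 : 0 ≤ M) (s : Finset ι) :
    ∃ θ : ι → ℝ, (∀ k, θ k = 0 ∨ θ k = Real.pi) ∧ |∑ k ∈ s, r k * Real.cos (θ k)| ≤ M := by
  induction s using Finset.induction_on with
  | empty => exact ⟨fun _ => 0, fun _ => Or.inl rfl, by simpa using hM0⟩
  | insert i s hi ih =>
    obtain ⟨θ, hθ, h⟩ := ih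
    have hsum : ∀ t, ∑ k ∈ s, r k * Real.cos (Function.update θ i t k) =
        ∑ k ∈ s, r k * Real.cos (θ k) := fun t => Finset.sum_congr rfl fun k hk => by
      rw [Function.update_of_ne (ne_of_mem_of_not_mem hk hi)]
    have hmem : ∀ t, (t = 0 ∨ t = Real.pi) →
        ∀ k, Function.update θ i t k = 0 ∨ Function.update θ i t k = Real.pi := by
      intro t ht k
      by_cases hk : k = i
      · subst hk; simpa using ht
      · simpa [hk] using hθ k
    have h1 := hr i
    have h2 := hM i
    obtain ⟨h3, h4⟩ := abs_le.1 h
    rcases le_total 0 (∑ k ∈ s, r k * Real.cos (θ k)) with h0 | h0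
    · refine ⟨Function.update θ i Real.pi, hmem _ (Or.inr rfl), ?_⟩
      rw [Finset.sum_insert hi, hsum, Function.update_self, Real.cos_pi, abs_le]
      constructor <;> linarith
    · refine ⟨Function.update θ i 0, hmem _ (Or.inl rfl), ?_⟩
      rw [Finset.sum_insert hi, hsum, Function.update_self, Real.cos_zero, abs_le]
      constructor <;> linarith

/-- Segments of given lengths can be arranged to a closed polygon in the plane if none is longer
than the sum of the others. With the longest side put aside, the end point of the chain of the other
sides takes every distance to the origin between that of a chain of signed sides and the sum of
their lengths. -/
theorem exists_closed_polygon {ι : Type*} [Fintype ι] [DecidableEq ι] [Nonempty ι] {r : ι → ℝ}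
    (hr : ∀ k, 0 ≤ r k) (h : ∀ i, r i ≤ ∑ k ∈ Finset.univ.erase i, r k) :
    ∃ c : ι → Circle, ∑ k, r k • (c k : ℂ) = 0 := by
  obtain ⟨i, hi⟩ := Finite.exists_max r
  let F : (ι → ℝ) → ℂ := fun θ => ∑ k ∈ Finset.univ.erase i, r k • (Circle.exp (θ k) : ℂ)
  have hF : Continuous F := by
    refine continuous_finsetSum _ fun k _ => ?_
    simp only [Complex.real_smul]
    exact continuous_const.mul <|
      continuous_subtype_val.comp (Circle.exp.continuous.comp (continuous_apply k))
  obtain ⟨θ, hθ⟩ : r i ∈ Set.range fun θ => ‖F θ‖ := by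
    refine mem_range_of_exists_le_of_exists_ge hF.norm ?_ ⟨0, ?_⟩
    · obtain ⟨θ, hθ, hle⟩ := exists_signed_sum_le hr hi (hr i) (Finset.univ.erase i)
      refine ⟨θ, ?_⟩
      have : F θ = ((∑ k ∈ Finset.univ.erase i, r k * Real.cos (θ k) : ℝ) : ℂ) := by
        rw [Complex.ofReal_sum]
        refine Finset.sum_congr rfl fun k _ => ?_
        rcases hθ k with h0 | h0 <;> simp [h0]
      simpa only [this, Complex.norm_real, Real.norm_eq_abs] using hle
    · have : F 0 = ((∑ k ∈ Finset.univ.erase i, r k : ℝ) : ℂ) := by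
        rw [Complex.ofReal_sum]
        exact Finset.sum_congr rfl fun k _ => by simp
      rw [this, Complex.norm_real]
      exact (h i).trans (le_abs_self _)
  refine ⟨fun k => Circle.exp (if k = i then (-F θ).arg else θ k), ?_⟩
  rw [← Finset.add_sum_erase _ _ (Finset.mem_univ i)]
  have h1 : ∑ k ∈ Finset.univ.erase i,
      r k • ((Circle.exp (if k = i then (-F θ).arg else θ k) : Circle) : ℂ) = F θ :=
    Finset.sum_congr rfl fun k hk => by rw [if_neg (Finset.ne_of_mem_erase hk)]
  rw [h1]
  change r i • ((Circle.exp (if i = i then _ else _) : Circle) : ℂ) + F θ = 0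
  rw [if_pos rfl, Circle.coe_exp, Complex.real_smul, ← hθ]
  have h2 := Complex.norm_mul_exp_arg_mul_I (-F θ)
  rw [norm_neg] at h2
  simp [h2]

/-- The logarithmic coordinates `0, y_1, ..., y_n` of the terms `1, z_1, ..., z_n`. -/
def homog : (Fin n → ℝ) →ₗ[ℝ] (Fin (n + 1) → ℝ) where
  toFun y := Fin.cons 0 y
  map_add' x y := by funext k; refine Fin.cases ?_ (fun j => ?_) k <;> simp
  map_smul' c x := by funext k; refine Fin.cases ?_ (fun j => ?_) k <;> simp

@[simp] theorem homog_zero (y : Fin n → ℝ) : homog y 0 = 0 := rfl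

@[simp] theorem homog_succ (y : Fin n → ℝ) (j : Fin n) : homog y j.succ = y j := rfl

/-- The component of the complement of the amoeba of the standard hyperplane over `ℂ` on which
the `i`-th term has absolute value larger than the sum of those of the other terms. -/
def dominated (i : Fin (n + 1)) : Set (Fin n → ℝ) :=
  {y | ∑ k ∈ Finset.univ.erase i, Real.exp (homog y k - homog y i) < 1}

/-- The points at which the `i`-th term has a strictly larger valuation than the others. -/
def tropDominated (i : Fin (n + 1)) : Set (Fin n → ℝ) :=
  {y | ∀ k, k ≠ i → homog y k < homog y i}

theorem continuous_homog : Continuous (homog (n := n)) :=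
  LinearMap.continuous_of_finiteDimensional _

theorem continuous_homog_apply (k : Fin (n + 1)) : Continuous fun y : Fin n → ℝ => homog y k :=
  (continuous_apply k).comp continuous_homog

theorem isOpen_dominated (i : Fin (n + 1)) : IsOpen (dominated i) := by
  refine isOpen_lt (continuous_finsetSum _ fun k _ => ?_) continuous_const
  exact Real.continuous_exp.comp ((continuous_homog_apply k).sub (continuous_homog_apply i))

theorem isOpen_tropDominated (i : Fin (n + 1)) : IsOpen (tropDominated i) := by
  have : tropDominated i = ⋂ k, ⋂ (_ : k ≠ i), {y | homog y k < homog y i} := by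
    ext y; simp [tropDominated]
  rw [this]
  exact isOpen_iInter_of_finite fun k => isOpen_iInter_of_finite fun _ =>
    isOpen_lt (continuous_homog_apply k) (continuous_homog_apply i)

theorem dominated_subset_tropDominated (i : Fin (n + 1)) : dominated i ⊆ tropDominated i := by
  intro y hy k hk
  have h1 : Real.exp (homog y k - homog y i) < 1 := lt_of_le_of_lt
    (Finset.single_le_sum (f := fun k => Real.exp (homog y k - homog y i))
      (fun _ _ => (Real.exp_pos _).le) (Finset.mem_erase.2 ⟨hk, Finset.mem_univ k⟩)) hy
  linarith [Real.exp_lt_one_iff.1 h1]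

theorem disjoint_tropDominated {i j : Fin (n + 1)} (h : i ≠ j) :
    Disjoint (tropDominated i) (tropDominated j) :=
  Set.disjoint_left.2 fun _ hi hj => lt_asymm (hi j h.symm) (hj i h)

theorem dominated_nonempty (i : Fin (n + 1)) : (dominated i).Nonempty := by
  obtain ⟨y, hy⟩ : ∃ y : Fin n → ℝ, ∀ k, k ≠ i → homog y k - homog y i = -n := by
    refine Fin.cases ⟨fun _ => -n, fun k => ?_⟩ (fun j => ⟨Pi.single j n, fun k => ?_⟩) i
    · refine Fin.cases (fun h => absurd rfl h) (fun l _ => by simp) k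
    · refine Fin.cases (fun _ => by simp) (fun l hl => ?_) k
      have : l ≠ j := fun e => hl (by rw [e])
      simp [this]
  refine ⟨y, ?_⟩
  have h1 : ∑ k ∈ Finset.univ.erase i, Real.exp (homog y k - homog y i) = n * Real.exp (-n) := by
    rw [Finset.sum_congr rfl fun k hk => by rw [hy k (Finset.ne_of_mem_erase hk)]]
    simp
  have h2 := Real.add_one_le_exp (n : ℝ)
  change ∑ k ∈ Finset.univ.erase i, Real.exp (homog y k - homog y i) < 1
  rw [h1, Real.exp_neg, ← div_eq_mul_inv, div_lt_one (Real.exp_pos _)]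
  linarith

theorem isConnected_dominated (i : Fin (n + 1)) : IsConnected (dominated i) := by
  have hconv : ∀ s : Finset (Fin (n + 1)), ConvexOn ℝ Set.univ fun y : Fin n → ℝ =>
      ∑ k ∈ s, Real.exp (homog y k - homog y i) := by
    intro s
    induction s using Finset.induction_on with
    | empty => simpa using convexOn_const 0 convex_univ
    | insert j s hj ih =>
      simp only [Finset.sum_insert hj]
      refine ConvexOn.add ?_ ih
      exact convexOn_exp.comp_linearMap
        (((LinearMap.proj j : (Fin (n + 1) → ℝ) →ₗ[ℝ] ℝ) -
          (LinearMap.proj i : (Fin (n + 1) → ℝ) →ₗ[ℝ] ℝ)) ∘ₗ homog)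
  have := (hconv (Finset.univ.erase i)).convex_lt 1
  simp only [Set.mem_univ, true_and] at this
  exact ⟨dominated_nonempty i, Convex.isPreconnected this⟩

theorem isConnected_tropDominated (i : Fin (n + 1)) : IsConnected (tropDominated i) := by
  refine ⟨(dominated_nonempty i).mono (dominated_subset_tropDominated i), Convex.isPreconnected ?_⟩
  intro x hx y hy a b ha hb hab k hk
  have h1 := hx k hk
  have h2 := hy k hk
  simp only [map_add, map_smul, Pi.add_apply, Pi.smul_apply, smul_eq_mul]
  rcases ha.eq_or_lt with rfl | ha
  · rw [zero_add] at hab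
    subst hab
    simpa using h2
  · nlinarith

theorem exp_homog_logC (z : Fin n → ℂˣ) (k : Fin (n + 1)) :
    Real.exp (homog (fun j => logC (z j)) k) =
      ‖(Fin.cons 1 (fun j => (z j : ℂ)) : Fin (n + 1) → ℂ) k‖ := by
  refine Fin.cases ?_ (fun j => ?_) k
  · simp
  · simp [logC, Real.exp_log]

/-- The amoeba consists of the logarithms of the side lengths `1, |z_1|, ..., |z_n|` of closed
polygons. -/
theorem compl_amoeba_stdPoly_complex :
    (amoeba logC (stdPoly ℂ n))ᶜ = ⋃ i, dominated i := by
  have hdom : ∀ (y : Fin n → ℝ) i, y ∈ dominated i ↔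
      ∑ k ∈ Finset.univ.erase i, Real.exp (homog y k) < Real.exp (homog y i) := fun y i => by
    simp only [dominated, Set.mem_ofPred_eq, Real.exp_sub, ← Finset.sum_div]
    rw [div_lt_one (Real.exp_pos _)]
  ext y
  rw [Set.mem_iUnion]
  constructor
  · intro hy
    by_contra! hall
    obtain ⟨c, hc⟩ := exists_closed_polygon (r := fun k => Real.exp (homog y k))
      (fun k => (Real.exp_pos _).le) fun i => not_lt.1 fun hlt => hall i ((hdom y i).2 hlt)
    refine hy ⟨fun j => Units.mk0 ((Real.exp (y j) : ℂ) * ((c j.succ / c 0 : Circle) : ℂ))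
      (mul_ne_zero (by exact_mod_cast (Real.exp_pos _).ne') (Circle.coe_ne_zero _)), ?_, ?_⟩
    · rw [mem_hypersurface_stdPoly]
      rw [Fin.sum_univ_succ] at hc
      simp only [homog_zero, homog_succ, Real.exp_zero, one_smul, Complex.real_smul] at hc
      have h0 := Circle.coe_ne_zero (c 0)
      refine (mul_left_inj' h0).1 (Eq.trans ?_ (hc.trans (zero_mul _).symm))
      rw [add_mul, one_mul, Finset.sum_mul]
      congr 1
      refine Finset.sum_congr rfl fun j _ => ?_
      rw [Units.val_mk0, Circle.coe_div, mul_assoc, div_mul_cancel₀ _ h0]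
    · funext j
      change Real.log ‖(Real.exp (y j) : ℂ) * ((c j.succ / c 0 : Circle) : ℂ)‖ = y j
      rw [norm_mul, Circle.norm_coe, mul_one, Complex.norm_real,
        Real.norm_eq_abs, abs_of_pos (Real.exp_pos _), Real.log_exp]
  · rintro ⟨i, hi⟩ ⟨z, hz, rfl⟩
    rw [hdom] at hi
    simp only [exp_homog_logC] at hi
    set v : Fin (n + 1) → ℂ := Fin.cons 1 fun j => (z j : ℂ) with hv
    have hsum : ∑ k, v k = 0 := by
      rw [Fin.sum_univ_succ]; exact mem_hypersurface_stdPoly.1 hz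
    rw [← Finset.add_sum_erase _ _ (Finset.mem_univ i), add_eq_zero_iff_eq_neg] at hsum
    refine absurd hi (not_lt.2 ?_)
    rw [hsum, norm_neg]
    exact norm_sum_le _ _

/-! ### The standard hyperplane over the generalized Puiseux series -/

theorem order_and_leadingCoeff {x : Puiseux} {m : ℝ} {a : ℂ} (ha : a ≠ 0) (hm : x.coeff m = a)
    (hlt : ∀ j < m, x.coeff j = 0) : x ≠ 0 ∧ x.order = m ∧ x.leadingCoeff = a := by
  have hx : x ≠ 0 := by rintro rfl; exact ha (by rw [← hm, HahnSeries.coeff_zero])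
  have ho : x.order = m := by
    refine le_antisymm (HahnSeries.order_le_of_coeff_ne_zero (by rw [hm]; exact ha)) ?_
    by_contra! hlt'
    exact hx (HahnSeries.coeff_order_eq_zero.1 (hlt _ hlt'))
  exact ⟨hx, ho, by rw [HahnSeries.leadingCoeff_eq, ho, hm]⟩

theorem valP_mul (x y : Puiseuxˣ) : valP (x * y) = valP x + valP y := by
  simp only [valP, Units.val_mul, HahnSeries.order_mul x.ne_zero y.ne_zero, neg_add]

/-- The coefficient of the term of least exponent, as a homomorphism. -/
noncomputable def leadHom : Puiseuxˣ →* ℂˣ :=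
  MonoidHom.mk' (fun x => Units.mk0 (x : Puiseux).leadingCoeff
    (HahnSeries.leadingCoeff_ne_zero.2 x.ne_zero)) fun x y => by
      ext; simp [HahnSeries.leadingCoeff_mul]

/-- The argument of the leading coefficient as a homomorphism. -/
noncomputable def argPHom : Puiseuxˣ →* Circle := argCHom.comp leadHom

theorem argP_eq_argPHom (x : Puiseuxˣ) : argP x = argPHom x := rfl

theorem argP_eq_of_leadingCoeff {x : Puiseuxˣ} {u : Circle} {r : ℝ} (hr : 0 < r)
    (h : (x : Puiseux).leadingCoeff = r * u) : argP x = u := by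
  rw [argP_eq_argPHom]
  exact argC_eq_of_pos (z := leadHom x) hr h

/-- Complex numbers of absolute value one as constant series. -/
noncomputable def constCircle : Circle →* Puiseuxˣ :=
  (Units.map (HahnSeries.C : ℂ →+* Puiseux).toMonoidHom).comp Circle.toUnits

theorem argP_constCircle (u : Circle) : argP (constCircle u) = u := by
  refine argP_eq_of_leadingCoeff one_pos ?_
  have : ((constCircle u : Puiseuxˣ) : Puiseux) = HahnSeries.single 0 (u : ℂ) := rfl
  rw [this, HahnSeries.leadingCoeff_of_single]
  simp

/-- The root is the binomial series of exponent `1 / d` at `y - 1`. -/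
theorem exists_pow_eq_of_orderTop_sub_one_pos {y : Puiseux} (hy : 0 < (y - 1).orderTop) (d : ℕ)
    (hd : d ≠ 0) : ∃ x : Puiseux, x ^ d = y := by
  have hpow : ∀ (r : ℚ) (m : ℕ), PowerSeries.binomialSeries ℂ r ^ m =
      PowerSeries.binomialSeries ℂ (m * r) := by
    intro r m
    induction m with
    | zero => simp
    | succ m ih => rw [pow_succ, ih, ← PowerSeries.binomialSeries_add]; push_cast; ring_nf
  refine ⟨PowerSeries.heval (y - 1) (PowerSeries.binomialSeries ℂ ((d : ℚ)⁻¹)), ?_⟩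
  rw [← map_pow, hpow, mul_inv_cancel₀ (by exact_mod_cast hd)]
  have h1 : PowerSeries.binomialSeries ℂ (1 : ℚ) = 1 + PowerSeries.X := by
    simpa using PowerSeries.binomialSeries_nat (R := ℚ) (A := ℂ) 1
  rw [h1, map_add, map_one, PowerSeries.heval_X _ hy]
  ring

theorem exists_pow_eq_puiseux (d : ℕ) (hd : d ≠ 0) (x : Puiseuxˣ) : ∃ y, y ^ d = x := by
  set a := (x : Puiseux).leadingCoeff with ha
  set m := (x : Puiseux).order with hm
  have ha0 : a ≠ 0 := HahnSeries.leadingCoeff_ne_zero.2 x.ne_zero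
  obtain ⟨b, hb⟩ := IsAlgClosed.exists_pow_nat_eq a (Nat.pos_of_ne_zero hd)
  let y : Puiseux := HahnSeries.single (-m) a⁻¹ * x
  have hy : 0 < (y - 1).orderTop := by
    have hs : HahnSeries.single (-m) a⁻¹ ≠ 0 := by simpa using ha0
    have hy0 : y ≠ 0 := mul_ne_zero hs x.ne_zero
    rw [HahnSeries.orderTop_self_sub_one_pos_iff]
    constructor
    · rw [← HahnSeries.order_eq_orderTop_of_ne_zero hy0, HahnSeries.order_mul hs x.ne_zero,
        HahnSeries.order_single (inv_ne_zero ha0), ← hm, neg_add_cancel]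
      rfl
    · rw [HahnSeries.leadingCoeff_mul, HahnSeries.leadingCoeff_of_single, ← ha,
        inv_mul_cancel₀ ha0]
  obtain ⟨z, hz⟩ := exists_pow_eq_of_orderTop_sub_one_pos hy d hd
  have hd' : (d : ℝ) ≠ 0 := by exact_mod_cast hd
  have hroot : (HahnSeries.single (m / d) b * z) ^ d = (x : Puiseux) := by
    rw [mul_pow, HahnSeries.single_pow, hb, hz, nsmul_eq_mul, mul_div_cancel₀ _ hd', ← mul_assoc,
      HahnSeries.single_mul_single, add_neg_cancel, mul_inv_cancel₀ ha0, HahnSeries.single_zero_one,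
      one_mul]
  have hne : HahnSeries.single (m / d) b * z ≠ 0 := by
    intro h0
    rw [h0, zero_pow hd] at hroot
    exact x.ne_zero hroot.symm
  exact ⟨Units.mk0 _ hne, Units.ext (by simpa using hroot)⟩

/-- The terms of largest valuation must cancel, which gives a nonnegative relation. Conversely, in a
nonnegative relation the points of vanishing weight are the leading coefficients of terms of smaller
valuation. -/
theorem coamoeba_stdPoly_puiseux : coamoeba argP (stdPoly Puiseux n) = nonnegRelation n := by
  classical
  ext u
  constructor
  · rintro ⟨z, hz, rfl⟩
    rw [mem_hypersurface_stdPoly] at hz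
    let Z : Fin (n + 1) → Puiseuxˣ := Fin.cons 1 z
    have hsum : ∑ k, (Z k : Puiseux) = 0 := by
      rw [Fin.sum_univ_succ]; simpa [Z] using hz
    obtain ⟨i, hi⟩ := Finite.exists_min fun k => (Z k : Puiseux).order
    set m := (Z i : Puiseux).order
    have harg : ∀ k, (Fin.cons 1 (fun j => argP (z j)) : Fin (n + 1) → Circle) k = argP (Z k) :=
      fun k => Fin.cases (by simp [Z, argP_eq_argPHom]) (fun j => by simp [Z]) k
    refine ⟨fun k => ‖(Z k : Puiseux).coeff m‖, fun k => norm_nonneg _, ⟨i, ?_⟩, ?_⟩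
    · rw [norm_pos_iff]
      exact fun h => (Z i).ne_zero (HahnSeries.coeff_order_eq_zero.1 h)
    · have hcoeff := congrArg (fun x : Puiseux => x.coeff m) hsum
      simp only [HahnSeries.coeff_sum, HahnSeries.coeff_zero] at hcoeff
      rw [← hcoeff]
      refine Finset.sum_congr rfl fun k _ => ?_
      rw [harg]
      rcases (hi k).eq_or_lt with h | h
      · have := coe_argC (leadHom (Z k))
        have hl : ((leadHom (Z k) : ℂˣ) : ℂ) = (Z k : Puiseux).coeff m := by
          change (Z k : Puiseux).leadingCoeff = _
          rw [HahnSeries.leadingCoeff_eq, ← h]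
        rw [hl] at this
        rw [Complex.real_smul, mul_comm]
        exact this
      · have h0 := HahnSeries.coeff_eq_zero_of_lt_order h
        simp [h0]
  · rintro ⟨w, hw, ⟨i, hi⟩, h⟩
    set v : Fin (n + 1) → Circle := Fin.cons 1 u with hv
    -- the vanishing weights become terms of order one, compensated in the `i`-th term
    let e : Fin (n + 1) → ℂ := fun k => if w k = 0 then (v k : ℂ) else 0
    let b : Fin (n + 1) → ℂ := fun k => e k - if k = i then ∑ l, e l else 0
    let Z : Fin (n + 1) → Puiseux := fun k =>
      HahnSeries.single 0 (w k • (v k : ℂ)) + HahnSeries.single 1 (b k)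
    have hZsum : ∑ k, Z k = 0 := by
      have hsingle : ∀ (m : ℝ) (F : Fin (n + 1) → ℂ),
          ∑ k, HahnSeries.single m (F k) = HahnSeries.single m (∑ k, F k) := fun m F =>
        (map_sum (HahnSeries.single.addMonoidHom m) F Finset.univ).symm
      have h1 : ∑ k, HahnSeries.single (0 : ℝ) (w k • (v k : ℂ)) = 0 := by
        rw [hsingle, h, map_zero]
      have h2 : ∑ k, HahnSeries.single (1 : ℝ) (b k) = 0 := by
        rw [hsingle]
        simp [b]
      rw [Finset.sum_add_distrib, h1, h2, add_zero]
    have hZ : ∀ k, Z k ≠ 0 ∧ ∃ r : ℝ, 0 < r ∧ (Z k).leadingCoeff = r * v k := by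
      intro k
      by_cases hk : w k = 0
      · have hki : k ≠ i := by rintro rfl; exact hi.ne' hk
        have hZk : Z k = HahnSeries.single 1 (v k : ℂ) := by simp [Z, b, e, hk, hki]
        rw [hZk]
        exact ⟨by simp, 1, one_pos, by rw [HahnSeries.leadingCoeff_of_single]; simp⟩
      · have hwk : 0 < w k := lt_of_le_of_ne (hw k) (Ne.symm hk)
        have hne : w k • (v k : ℂ) ≠ 0 := smul_ne_zero hk (Circle.coe_ne_zero _)
        obtain ⟨h1, -, h2⟩ := order_and_leadingCoeff (x := Z k) (m := 0) hne
          (by simp [Z, HahnSeries.coeff_single_of_ne]) fun j hj => by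
            simp only [Z, HahnSeries.coeff_add]
            rw [HahnSeries.coeff_single_of_ne hj.ne,
              HahnSeries.coeff_single_of_ne (hj.trans one_pos).ne, add_zero]
        exact ⟨h1, w k, hwk, by rw [h2, Complex.real_smul]⟩
    let U : Fin (n + 1) → Puiseuxˣ := fun k => Units.mk0 (Z k) (hZ k).1
    have hU : ∀ k, argPHom (U k) = v k := fun k => by
      obtain ⟨r, hr, hl⟩ := (hZ k).2
      exact argP_eq_of_leadingCoeff hr hl
    refine ⟨fun j => U j.succ / U 0, ?_, ?_⟩
    · rw [mem_hypersurface_stdPoly]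
      have h0 : (U 0 : Puiseux) ≠ 0 := (U 0).ne_zero
      rw [← mul_left_inj' h0, zero_mul, ← hZsum, Fin.sum_univ_succ, add_mul, one_mul,
        Finset.sum_mul]
      congr 1
      refine Finset.sum_congr rfl fun j _ => ?_
      rw [← Units.val_mul, div_mul_cancel]
      rfl
    · funext j
      change argPHom _ = _
      rw [map_div, hU, hU]
      simp [hv]

/-- The amoeba is the tropical hyperplane, where the maximum is attained at least twice. -/
theorem compl_amoeba_stdPoly_puiseux :
    (amoeba valP (stdPoly Puiseux n))ᶜ = ⋃ i, tropDominated i := by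
  classical
  ext y
  rw [Set.mem_iUnion]
  constructor
  · intro hy
    by_contra! hall
    refine hy ?_
    -- the maximum is attained at least twice, so at some `i + 1`
    obtain ⟨m, hm⟩ := Finite.exists_max (homog y)
    obtain ⟨i, hi, l, hl, hil⟩ : ∃ i : Fin n, (∀ k, homog y k ≤ y i) ∧
        ∃ l, l ≠ i.succ ∧ homog y l = y i := by
      have h1 := hall m
      simp only [tropDominated, Set.mem_ofPred_eq, not_forall, not_lt] at h1
      obtain ⟨l, hlm, hl⟩ := h1
      have hlm' : homog y l = homog y m := le_antisymm (hm l) hl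
      rcases Fin.eq_zero_or_eq_succ m with h0 | ⟨i, rfl⟩
      · rcases Fin.eq_zero_or_eq_succ l with h0' | ⟨i, rfl⟩
        · exact absurd (h0'.trans h0.symm) hlm
        · exact ⟨i, fun k => (hm k).trans hl, m, hlm.symm, hlm'.symm⟩
      · exact ⟨i, hm, l, hlm, hlm'⟩
    let S : Puiseux := ∑ k ∈ Finset.univ.erase i.succ, HahnSeries.single (-homog y k) (1 : ℂ)
    have hScoeff : ∀ j, S.coeff j =
        ((Finset.univ.erase i.succ).filter fun k => j = -homog y k).card := by
      intro j
      simp only [S, HahnSeries.coeff_sum, HahnSeries.coeff_single, Finset.card_filter]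
      push_cast
      refine Finset.sum_congr rfl fun k _ => ?_
      split_ifs <;> simp_all
    obtain ⟨hS0, hSo, -⟩ := order_and_leadingCoeff (x := S) (m := -y i) (a := S.coeff (-y i))
      (by
        rw [hScoeff, Nat.cast_ne_zero, ← Nat.pos_iff_ne_zero, Finset.card_pos]
        exact ⟨l, by simp [hl, hil]⟩) rfl (by
        intro j hj
        rw [hScoeff, Nat.cast_eq_zero, Finset.card_eq_zero, Finset.filter_eq_empty_iff]
        intro k _ hk
        linarith [hi k])
    let z : Fin n → Puiseuxˣ := fun j => if j = i then Units.mk0 (-S) (neg_ne_zero.2 hS0) else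
      Units.mk0 (HahnSeries.single (-y j) (1 : ℂ)) (by simp)
    refine ⟨z, ?_, ?_⟩
    · rw [mem_hypersurface_stdPoly]
      have h1 : S = 1 + ∑ j ∈ Finset.univ.erase i, (z j : Puiseux) := by
        have h2 : ∀ F : Fin (n + 1) → Puiseux, ∑ k ∈ Finset.univ.erase i.succ, F k =
            F 0 + ∑ j ∈ Finset.univ.erase i, F j.succ := by
          intro F
          have h3 := Finset.add_sum_erase Finset.univ F (Finset.mem_univ i.succ)
          have h4 := Finset.add_sum_erase Finset.univ (fun j => F j.succ) (Finset.mem_univ i)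
          rw [Fin.sum_univ_succ, ← h4] at h3
          linear_combination h3
        rw [show S = _ from h2 _]
        congr 1
        · simp
        · refine Finset.sum_congr rfl fun j hj => ?_
          simp [z, Finset.ne_of_mem_erase hj]
      rw [← Finset.add_sum_erase _ _ (Finset.mem_univ i)]
      have h5 : (z i : Puiseux) = -S := by simp [z]
      rw [h5]
      linear_combination -h1
    · funext j
      by_cases hj : j = i
      · subst hj; simp [z, valP, hSo, HahnSeries.order_neg]
      · simp [z, valP, hj]
  · rintro ⟨i, hi⟩ ⟨z, hz, rfl⟩
    let Z : Fin (n + 1) → Puiseuxˣ := Fin.cons 1 z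
    have hsum : ∑ k, (Z k : Puiseux) = 0 := by
      rw [Fin.sum_univ_succ]; exact mem_hypersurface_stdPoly.1 hz
    have hval : ∀ k, homog (fun j => valP (z j)) k = -(Z k : Puiseux).order := fun k =>
      Fin.cases (by simp [Z]) (fun j => by simp [Z, valP]) k
    have hcoeff := congrArg (fun x : Puiseux => x.coeff (Z i : Puiseux).order) hsum
    simp only [HahnSeries.coeff_sum, HahnSeries.coeff_zero] at hcoeff
    rw [Finset.sum_eq_single i (fun k _ hk => ?_) (by simp)] at hcoeff
    · exact (Z i).ne_zero (HahnSeries.coeff_order_eq_zero.1 hcoeff)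
    · refine HahnSeries.coeff_eq_zero_of_lt_order ?_
      have := hi k hk
      rw [hval, hval] at this
      linarith

/-! ### The volume of a simplex -/

/-- The simplex with vertices `0, t e_1, ..., t e_n`. -/
def cornerSimplex (n : ℕ) (t : ℝ) : Set (Fin n → ℝ) := {x | (∀ j, 0 ≤ x j) ∧ ∑ j, x j ≤ t}

theorem convex_cornerSimplex (t : ℝ) : Convex ℝ (cornerSimplex n t) := by
  rintro x ⟨hx, hxt⟩ y ⟨hy, hyt⟩ a b ha hb hab
  refine ⟨fun j => ?_, ?_⟩
  · have := mul_nonneg ha (hx j)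
    have := mul_nonneg hb (hy j)
    simp only [Pi.add_apply, Pi.smul_apply, smul_eq_mul]
    linarith
  · simp only [Pi.add_apply, Pi.smul_apply, smul_eq_mul, Finset.sum_add_distrib, ← Finset.mul_sum]
    calc a * ∑ j, x j + b * ∑ j, y j ≤ a * t + b * t :=
          add_le_add (mul_le_mul_of_nonneg_left hxt ha) (mul_le_mul_of_nonneg_left hyt hb)
      _ = t := by rw [← add_mul, hab, one_mul]

theorem volume_cornerSimplex (n : ℕ) {t : ℝ} (ht : 0 ≤ t) :
    MeasureTheory.volume (cornerSimplex n t) = ENNReal.ofReal (t ^ n / n !) := by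
  induction n generalizing t with
  | zero =>
    have : cornerSimplex 0 t = Set.univ := by ext x; simp [cornerSimplex, ht]
    rw [this, MeasureTheory.volume_pi, MeasureTheory.Measure.pi_univ]
    simp
  | succ n ih =>
    -- the slice at a first coordinate `s` is the corner simplex of size `t - s`
    let S : Set (ℝ × (Fin n → ℝ)) := {p | 0 ≤ p.1 ∧ (∀ j, 0 ≤ p.2 j) ∧ p.1 + ∑ j, p.2 j ≤ t}
    have hS : MeasurableSet S := by
      refine IsClosed.measurableSet ?_
      refine (isClosed_le continuous_const continuous_fst).inter (IsClosed.inter ?_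
        (isClosed_le (f := fun p : ℝ × (Fin n → ℝ) => p.1 + ∑ j, p.2 j) (by fun_prop)
          continuous_const))
      have : {p : ℝ × (Fin n → ℝ) | ∀ j, 0 ≤ p.2 j} = ⋂ j, {p | 0 ≤ p.2 j} := by ext; simp
      change IsClosed {p : ℝ × (Fin n → ℝ) | ∀ j, 0 ≤ p.2 j}
      rw [this]
      exact isClosed_iInter fun j => isClosed_le continuous_const (by fun_prop)
    have hpre : cornerSimplex (n + 1) t =
        MeasurableEquiv.piFinSuccAbove (fun _ => ℝ) 0 ⁻¹' S := by
      ext x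
      simp [cornerSimplex, S, Fin.sum_univ_succ, Fin.forall_fin_succ, Fin.tail, and_assoc]
    have hslice : ∀ s, MeasureTheory.volume (Prod.mk s ⁻¹' S) =
        (Set.Icc 0 t).indicator (fun s => ENNReal.ofReal ((t - s) ^ n / n !)) s := by
      intro s
      by_cases hs : s ∈ Set.Icc 0 t
      · rw [Set.indicator_of_mem hs, ← ih (sub_nonneg.2 hs.2)]
        congr 1
        ext x
        simp [S, cornerSimplex, hs.1, le_sub_iff_add_le']
      · rw [Set.indicator_of_notMem hs]
        convert MeasureTheory.measure_empty (μ := MeasureTheory.volume)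
        refine Set.eq_empty_of_forall_notMem fun x hx => hs ⟨hx.1, ?_⟩
        have := Finset.sum_nonneg fun j (_ : j ∈ Finset.univ) => hx.2.1 j
        have := hx.2.2
        simp only at *
        linarith
    rw [hpre, (MeasureTheory.volume_preserving_piFinSuccAbove (fun _ => ℝ) 0).measure_preimage
      hS.nullMeasurableSet, MeasureTheory.Measure.volume_eq_prod,
      MeasureTheory.Measure.prod_apply hS]
    simp only [hslice]
    have hcont : Continuous fun s : ℝ => (t - s) ^ n / n ! := by fun_prop
    rw [MeasureTheory.lintegral_indicator measurableSet_Icc,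
      ← MeasureTheory.ofReal_integral_eq_lintegral_ofReal
        (hcont.integrableOn_Icc)
        ((MeasureTheory.ae_restrict_iff' measurableSet_Icc).2 (Filter.Eventually.of_forall
          fun s hs => div_nonneg (pow_nonneg (sub_nonneg.2 hs.2) _) (Nat.cast_nonneg _))),
      MeasureTheory.integral_Icc_eq_integral_Ioc, ← intervalIntegral.integral_of_le ht,
      intervalIntegral.integral_comp_sub_left (fun x => x ^ n / (n ! : ℝ)) t,
      intervalIntegral.integral_div, integral_pow, Nat.factorial_succ]
    congr 1
    push_cast
    rw [sub_self, sub_zero, zero_pow (Nat.succ_ne_zero n), sub_zero, div_div]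

theorem convexHull_range_eq_image_cornerSimplex (v : Fin (n + 1) → Fin n → ℝ) :
    convexHull ℝ (Set.range v) = (fun x => v 0 + x) ''
      (Matrix.toLin' (Matrix.of fun j k => v k.succ j - v 0 j) '' cornerSimplex n 1) := by
  set f := Matrix.toLin' (Matrix.of fun j (k : Fin n) => v k.succ j - v 0 j) with hf
  have hfx : ∀ x, f x = ∑ k, x k • (v k.succ - v 0) := fun x => by
    funext j
    simp [hf, Matrix.mulVec, dotProduct, mul_comm]
  refine subset_antisymm
    (convexHull_min ?_ (((convex_cornerSimplex 1).linear_image f).translate (v 0))) ?_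
  · rintro _ ⟨k, rfl⟩
    refine Fin.cases ?_ (fun i => ?_) k
    · exact ⟨0, ⟨0, by simp [cornerSimplex], map_zero f⟩, add_zero _⟩
    · refine ⟨_, ⟨Pi.single i 1, ⟨fun j => ?_, by simp⟩, rfl⟩, ?_⟩
      · by_cases h : j = i
        · subst h; simp
        · simp [h]
      · simp only [hfx]
        rw [Finset.sum_eq_single i (fun j _ hj => by simp [hj]) (by simp)]
        simp
  · rintro _ ⟨_, ⟨x, ⟨hx, hx1⟩, rfl⟩, rfl⟩
    refine mem_convexHull_of_exists_fintype (Fin.cons (1 - ∑ j, x j) x : Fin (n + 1) → ℝ) v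
      (fun k => ?_) ?_ (fun k => Set.mem_range_self k) ?_
    · exact Fin.cases (sub_nonneg.2 hx1) (fun j => hx j) k
    · simp [Fin.sum_univ_succ]
    · simp only [Fin.sum_univ_succ, Fin.cons_zero, Fin.cons_succ, hfx, smul_sub,
        Finset.sum_sub_distrib, ← Finset.sum_smul, sub_smul, one_smul]
      abel

theorem volume_convexHull_range (v : Fin (n + 1) → Fin n → ℝ) :
    MeasureTheory.volume (convexHull ℝ (Set.range v)) =
      ENNReal.ofReal |(Matrix.of fun j (k : Fin n) => v k.succ j - v 0 j).det| *
        ENNReal.ofReal (1 / n !) := by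
  rw [convexHull_range_eq_image_cornerSimplex, Set.image_add_left,
    MeasureTheory.measure_preimage_add, MeasureTheory.Measure.addHaar_image_linearMap,
    LinearMap.det_toLin', volume_cornerSimplex n zero_le_one, one_pow]

/-! ### Labellings of the vertices -/

section Labelling

variable {K : Type*} [Field K]

theorem toReal_injective : Function.Injective (toReal (n := n)) := fun a b h => by
  funext j
  have := congrFun h j
  simp only [toReal] at this
  exact_mod_cast this

theorem range_subset_of_convexHull_eq {p : Fin (n + 1) → Fin n → ℝ}
    (hp : AffineIndependent ℝ p) {E : Set (Fin n → ℝ)} (hE : E ⊆ Set.range p)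
    (h : convexHull ℝ (Set.range p) = convexHull ℝ E) : Set.range p ⊆ E := by
  rintro _ ⟨i, rfl⟩
  by_contra hi
  refine hp.notMem_affineSpan_sdiff i Set.univ ?_
  have h1 : p i ∈ convexHull ℝ E := h ▸ subset_convexHull ℝ _ (Set.mem_range_self i)
  refine affineSpan_mono ℝ ?_ (convexHull_subset_affineSpan E h1)
  intro x hx
  obtain ⟨k, rfl⟩ := hE hx
  exact ⟨k, ⟨Set.mem_univ k, fun hk => hi (Set.mem_singleton_iff.1 hk ▸ hx)⟩, rfl⟩

/-- The support consists of the vertices of the simplex. -/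
theorem exists_affineIndependent_range_eq {f : LaurentPoly K n} (hf : IsSimplex (newtonPolytope f))
    (hv : toReal '' supp f = (newtonPolytope f).extremePoints ℝ) :
    ∃ p : Fin (n + 1) → Fin n → ℝ, AffineIndependent ℝ p ∧ Set.range p = toReal '' supp f := by
  obtain ⟨p, hp, hP⟩ := hf
  have hsub : toReal '' supp f ⊆ Set.range p := by
    rw [hv, hP]
    exact extremePoints_convexHull_subset
  exact ⟨p, hp, (range_subset_of_convexHull_eq hp hsub hP.symm).antisymm hsub⟩

theorem exists_isLabelling {f : LaurentPoly K n} (hf : IsSimplex (newtonPolytope f))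
    (hv : toReal '' supp f = (newtonPolytope f).extremePoints ℝ) :
    ∃ (α : Fin (n + 1) → Fin n → ℤ) (c : Fin (n + 1) → Kˣ), IsLabelling f α c := by
  obtain ⟨p, hp, hrange⟩ := exists_affineIndependent_range_eq hf hv
  have hmem : ∀ k, ∃ a, a ∈ supp f ∧ toReal a = p k := fun k => by
    have : p k ∈ toReal '' supp f := hrange ▸ Set.mem_range_self k
    exact this
  choose α hα hαp using hmem
  refine ⟨α, fun k => Units.mk0 _ (hα k), fun i j hij => hp.injective ?_, ?_, fun k => rfl⟩
  · rw [← hαp, ← hαp, hij]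
  · ext a
    constructor
    · rintro ⟨k, rfl⟩; exact hα k
    · intro ha
      obtain ⟨k, hk⟩ : toReal a ∈ Set.range p := hrange ▸ Set.mem_image_of_mem _ ha
      exact ⟨k, toReal_injective (by rw [hαp, hk])⟩

theorem det_simplexMatrix_ne_zero {f : LaurentPoly K n} (hf : IsSimplex (newtonPolytope f))
    (hv : toReal '' supp f = (newtonPolytope f).extremePoints ℝ)
    {α : Fin (n + 1) → Fin n → ℤ} {c : Fin (n + 1) → Kˣ} (h : IsLabelling f α c) :
    (simplexMatrix α).det ≠ 0 := by
  obtain ⟨p, hp, hrange⟩ := exists_affineIndependent_range_eq hf hv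
  have hr : Set.range (toReal ∘ α) = Set.range p := by rw [Set.range_comp, h.2.1, hrange]
  have hind : AffineIndependent ℝ (toReal ∘ α) := by
    refine AffineIndependent.of_set_of_injective ?_ (toReal_injective.comp h.1)
    rw [hr]
    exact hp.range
  have hlin := (affineIndependent_iff_linearIndependent_vsub ℝ _ (0 : Fin (n + 1))).1 hind
  have hcol : LinearIndependent ℝ (simplexMatrix α).col := by
    have := hlin.comp
      (fun k : Fin n => (⟨k.succ, Fin.succ_ne_zero k⟩ : {x : Fin (n + 1) // x ≠ 0}))
      fun i j hij => Fin.succ_injective _ (Subtype.ext_iff.1 hij)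
    have hcols : (simplexMatrix α).col =
        fun k : Fin n => (toReal ∘ α) k.succ -ᵥ (toReal ∘ α) 0 := by
      funext k j
      simp [simplexMatrix, toReal]
    rw [hcols]
    exact this
  exact ((Matrix.isUnit_iff_isUnit_det _).1
    (Matrix.linearIndependent_cols_iff_isUnit.1 hcol)).ne_zero

theorem factorial_mul_volume_newtonPolytope {f : LaurentPoly K n} {α : Fin (n + 1) → Fin n → ℤ}
    {c : Fin (n + 1) → Kˣ} (h : IsLabelling f α c) :
    (n ! : ℝ≥0∞) * MeasureTheory.volume (newtonPolytope f) = (edgeMatrix α).det.natAbs := by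
  have hdet : (Matrix.of fun j (k : Fin n) => (toReal ∘ α) k.succ j - (toReal ∘ α) 0 j).det =
      ((edgeMatrix α).det : ℝ) := by
    rw [← det_simplexMatrix]
    congr 1
    ext j k
    simp [simplexMatrix, toReal]
  rw [newtonPolytope, ← h.2.1, ← Set.range_comp, volume_convexHull_range, hdet, mul_left_comm,
    ← ENNReal.ofReal_natCast, ← ENNReal.ofReal_mul (Nat.cast_nonneg _),
    mul_one_div_cancel (by exact_mod_cast Nat.factorial_ne_zero n), ENNReal.ofReal_one, mul_one,
    ← Int.cast_abs, Int.abs_eq_natAbs, Int.cast_natCast, ENNReal.ofReal_natCast]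

theorem encard_extremePoints {f : LaurentPoly K n}
    (hv : toReal '' supp f = (newtonPolytope f).extremePoints ℝ)
    {α : Fin (n + 1) → Fin n → ℤ} {c : Fin (n + 1) → Kˣ} (h : IsLabelling f α c) :
    ((newtonPolytope f).extremePoints ℝ).encard = ENat.card (Fin (n + 1)) := by
  rw [← hv, toReal_injective.encard_image, ← h.2.1, ← Set.image_univ, h.1.encard_image,
    Set.encard_univ]

end Labelling

/-! ### The general statement -/

/-- The map `pullMap L v` as a homeomorphism when `L` is invertible. -/
noncomputable def pullHomeomorph {L : Matrix (Fin n) (Fin n) ℝ} (hL : L.det ≠ 0) (v : Fin n → ℝ) :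
    (Fin n → ℝ) ≃ₜ (Fin n → ℝ) where
  toFun := pullMap L v
  invFun x := Lᵀ *ᵥ x + v
  left_inv x := by
    have : IsUnit Lᵀ.det := by rw [Matrix.det_transpose]; exact hL.isUnit
    change Lᵀ *ᵥ (Lᵀ⁻¹ *ᵥ (x - v)) + v = x
    rw [Matrix.mulVec_mulVec, Matrix.mul_nonsing_inv _ this, Matrix.one_mulVec, sub_add_cancel]
  right_inv x := by
    have : IsUnit Lᵀ.det := by rw [Matrix.det_transpose]; exact hL.isUnit
    rw [pullMap, add_sub_cancel_right, Matrix.mulVec_mulVec, Matrix.nonsing_inv_mul _ this,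
      Matrix.one_mulVec]
  continuous_toFun := by unfold pullMap; fun_prop
  continuous_invFun := by fun_prop

theorem card_connectedComponents_compl_image {ι X Y : Type*} [TopologicalSpace X]
    [TopologicalSpace Y] (e : X ≃ₜ Y) {S : Set X} {R : ι → Set X} (hS : Sᶜ = ⋃ i, R i)
    (hopen : ∀ i, IsOpen (R i)) (hconn : ∀ i, IsConnected (R i))
    (hdisj : ∀ i j, i ≠ j → Disjoint (R i) (R j)) :
    ENat.card (ConnectedComponents ((e '' S)ᶜ : Set Y)) = ENat.card ι := by
  have hc : (e '' S)ᶜ = ⋃ i, e '' R i := by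
    rw [← Set.image_iUnion, ← hS, Set.image_compl_eq e.bijective]
  refine card_connectedComponents_subset (R := fun i => e '' R i) (O := fun i => e '' R i)
    (fun i => e.isOpenMap _ (hopen i)) (fun i => ?_)
    (fun i => (hconn i).image e e.continuous.continuousOn)
    (fun i j hij => (Set.disjoint_image_iff e.injective).2 (hdisj i j hij)) hc.le
  rw [eq_comm, Set.inter_eq_right, hc]
  exact Set.subset_iUnion (fun i => e '' R i) i

theorem continuous_monomialMap (ℓ : Matrix (Fin n) (Fin n) ℤ) (b : Fin n → Circle) :
    Continuous (monomialMap ℓ b) :=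
  continuous_pi fun _ => continuous_const.mul
    (continuous_finsetProd _ fun j _ => (continuous_apply j).zpow _)

theorem isOpenMap_monomialMap {ℓ : Matrix (Fin n) (Fin n) ℤ} (hℓ : ℓ.det ≠ 0)
    (b : Fin n → Circle) : IsOpenMap (monomialMap ℓ b) := by
  obtain ⟨γ, rfl⟩ := torusExp_surjective b
  have hL : (ℓ.map (Int.cast : ℤ → ℝ)).det ≠ 0 := by
    have : (ℓ.map (Int.cast : ℤ → ℝ)).det = (ℓ.det : ℝ) :=
      (RingHom.map_det (Int.castRingHom ℝ) ℓ).symm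
    rw [this]; exact_mod_cast hℓ
  intro U hU
  have : monomialMap ℓ (torusExp γ) '' U =
      torusExp '' ((pullHomeomorph hL γ).symm '' (torusExp ⁻¹' U)) := by
    rw [Set.image_image]
    conv_lhs => rw [← Set.image_preimage_eq U torusExp_surjective, Set.image_image]
    exact Set.image_congr fun x _ => monomialMap_torusExp ℓ γ x
  rw [this]
  exact isOpenMap_torusExp _
    ((pullHomeomorph hL γ).symm.isOpenMap _ (hU.preimage continuous_torusExp))

theorem card_connectedComponents_compl_preimage {ℓ : Matrix (Fin n) (Fin n) ℤ} (hℓ : ℓ.det ≠ 0)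
    (b : Fin n → Circle) {S : Set (Fin n → Circle)} {B : Set (Fin (n + 1) → ℝ)}
    (hS : Sᶜ = torusExp '' (phaseDiff '' B)) (hB : B ⊆ halfBox n)
    (hconn : IsConnected (phaseDiff '' B)) :
    ENat.card (ConnectedComponents ((monomialMap ℓ b ⁻¹' S)ᶜ : Set (Fin n → Circle))) =
      (ℓ.det.natAbs : ℕ) := by
  rw [← Set.preimage_compl, hS]
  refine card_connectedComponents_preimage_monomialMap hℓ b hconn isCompact_phaseDiff_closedBox
    (Set.image_mono fun x hx => (hB hx).1) ?_
  rintro _ ⟨x, hx, rfl⟩ _ ⟨y, hy, rfl⟩ k hk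
  exact period_eq_zero_of_phaseDiff (hB hx) hy hk

/-- The statement for a field with a valuation and an argument map, reduced to the descriptions of
the complements of the amoeba (`R`) and of the coamoeba (`B`) of the standard hyperplane. -/
theorem amoeba_and_coamoeba_of_simplex {K : Type*} [Field K] {ν : Kˣ → ℝ}
    (hν : ∀ x y, ν (x * y) = ν x + ν y) (θ : Kˣ →* Circle) (s : Circle →* Kˣ)
    (hs : ∀ u, θ (s u) = u) (hdiv : ∀ d : ℕ, d ≠ 0 → ∀ x : Kˣ, ∃ y, y ^ d = x)
    {R : Fin (n + 1) → Set (Fin n → ℝ)} (hR : (amoeba ν (stdPoly K n))ᶜ = ⋃ i, R i)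
    (hRopen : ∀ i, IsOpen (R i)) (hRconn : ∀ i, IsConnected (R i))
    (hRdisj : ∀ i j, i ≠ j → Disjoint (R i) (R j)) {B : Set (Fin (n + 1) → ℝ)}
    (hB : (coamoeba θ (stdPoly K n))ᶜ = torusExp '' (phaseDiff '' B)) (hBsub : B ⊆ halfBox n)
    (hBconn : IsConnected (phaseDiff '' B))
    (hclosure : closure (coamoeba θ (stdPoly K n)) = nonnegRelation n)
    (f : LaurentPoly K n) (hf : IsSimplex (newtonPolytope f))
    (hv : toReal '' supp f = (newtonPolytope f).extremePoints ℝ) :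
    (∀ (α : Fin (n + 1) → Fin n → ℤ) (c : Fin (n + 1) → Kˣ), IsLabelling f α c →
      (simplexMatrix α).det ≠ 0 ∧
      amoeba ν f = pullMap (simplexMatrix α) (fun k => ν (c k.succ / c 0)) ''
        amoeba ν (stdPoly K n) ∧
      ∀ γ : Fin n → ℝ, (∀ k, Circle.exp (γ k) = θ (c k.succ / c 0)) →
        lift (coamoeba θ f) = pullMap (simplexMatrix α) γ '' lift (coamoeba θ (stdPoly K n))) ∧
    IsSolid (amoeba ν f) (newtonPolytope f) ∧
    (ENat.card (ConnectedComponents ((coamoeba θ f)ᶜ : Set (Fin n → Circle))) : ℝ≥0∞) =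
      n ! * MeasureTheory.volume (newtonPolytope f) ∧
    (ENat.card (ConnectedComponents ((closure (coamoeba θ f))ᶜ : Set (Fin n → Circle))) : ℝ≥0∞) =
      n ! * MeasureTheory.volume (newtonPolytope f) := by
  have hdetZ : ∀ {α : Fin (n + 1) → Fin n → ℤ}, (simplexMatrix α).det ≠ 0 →
      (edgeMatrix α).det ≠ 0 := fun {α} h => by
    rw [det_simplexMatrix] at h; exact_mod_cast h
  refine ⟨fun α c hα => ?_, ?_⟩
  · have hdet := det_simplexMatrix_ne_zero hf hv hα
    refine ⟨hdet, amoeba_eq_image_pullMap hν hdiv hα hdet, fun γ hγ => ?_⟩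
    rw [coamoeba_eq_preimage θ s hs hdiv hα (hdetZ hdet), ← lift_preimage_monomialMap hdet]
    have : torusExp γ = fun k => θ (c k.succ / c 0) := funext hγ
    rw [this]
  · obtain ⟨α, c, hα⟩ := exists_isLabelling hf hv
    have hdet := det_simplexMatrix_ne_zero hf hv hα
    have hco := coamoeba_eq_preimage θ s hs hdiv hα (hdetZ hdet)
    refine ⟨?_, ?_, ?_⟩
    · rw [IsSolid, encard_extremePoints hv hα, amoeba_eq_image_pullMap hν hdiv hα hdet]
      exact card_connectedComponents_compl_image (pullHomeomorph hdet _) hR hRopen hRconn hRdisj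
    · rw [factorial_mul_volume_newtonPolytope hα, hco,
        card_connectedComponents_compl_preimage (hdetZ hdet) _ hB hBsub hBconn]
      simp
    · rw [factorial_mul_volume_newtonPolytope hα, hco,
        ← (isOpenMap_monomialMap (hdetZ hdet) _).preimage_closure_eq_closure_preimage
          (continuous_monomialMap _ _), hclosure,
        card_connectedComponents_compl_preimage (hdetZ hdet) _ compl_nonnegRelation
          openBox_subset_halfBox isConnected_phaseDiff_openBox]
      simp

end Amoeba

theorem lemma3p1 (n : ℕ) (hn : 1 ≤ n) :
    -- the complex numbers
    (∀ f : Amoeba.LaurentPoly ℂ n,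
      Amoeba.IsSimplex (Amoeba.newtonPolytope f) →
      Amoeba.toReal '' Amoeba.supp f = (Amoeba.newtonPolytope f).extremePoints ℝ →
        (∀ (α : Fin (n + 1) → Fin n → ℤ) (c : Fin (n + 1) → ℂˣ), Amoeba.IsLabelling f α c →
          (Amoeba.simplexMatrix α).det ≠ 0 ∧
          Amoeba.amoeba Amoeba.logC f =
            Amoeba.pullMap (Amoeba.simplexMatrix α) (fun k => Amoeba.logC (c k.succ / c 0)) ''
              Amoeba.amoeba Amoeba.logC (Amoeba.stdPoly ℂ n) ∧
          ∀ γ : Fin n → ℝ, (∀ k, Circle.exp (γ k) = Amoeba.argC (c k.succ / c 0)) →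
            Amoeba.lift (Amoeba.coamoeba Amoeba.argC f) =
              Amoeba.pullMap (Amoeba.simplexMatrix α) γ ''
                Amoeba.lift (Amoeba.coamoeba Amoeba.argC (Amoeba.stdPoly ℂ n))) ∧
        Amoeba.IsSolid (Amoeba.amoeba Amoeba.logC f) (Amoeba.newtonPolytope f) ∧
        (ENat.card (ConnectedComponents
            ((Amoeba.coamoeba Amoeba.argC f)ᶜ : Set (Fin n → Circle))) : ℝ≥0∞) =
          n ! * MeasureTheory.volume (Amoeba.newtonPolytope f) ∧
        (ENat.card (ConnectedComponents
            ((closure (Amoeba.coamoeba Amoeba.argC f))ᶜ : Set (Fin n → Circle))) : ℝ≥0∞) =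
          n ! * MeasureTheory.volume (Amoeba.newtonPolytope f)) ∧
    -- the generalized Puiseux series
    (∀ f : Amoeba.LaurentPoly Amoeba.Puiseux n,
      Amoeba.IsSimplex (Amoeba.newtonPolytope f) →
      Amoeba.toReal '' Amoeba.supp f = (Amoeba.newtonPolytope f).extremePoints ℝ →
        (∀ (α : Fin (n + 1) → Fin n → ℤ) (c : Fin (n + 1) → (Amoeba.Puiseux)ˣ),
          Amoeba.IsLabelling f α c →
          (Amoeba.simplexMatrix α).det ≠ 0 ∧
          Amoeba.amoeba Amoeba.valP f =
            Amoeba.pullMap (Amoeba.simplexMatrix α) (fun k => Amoeba.valP (c k.succ / c 0)) ''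
              Amoeba.amoeba Amoeba.valP (Amoeba.stdPoly Amoeba.Puiseux n) ∧
          ∀ γ : Fin n → ℝ, (∀ k, Circle.exp (γ k) = Amoeba.argP (c k.succ / c 0)) →
            Amoeba.lift (Amoeba.coamoeba Amoeba.argP f) =
              Amoeba.pullMap (Amoeba.simplexMatrix α) γ ''
                Amoeba.lift (Amoeba.coamoeba Amoeba.argP (Amoeba.stdPoly Amoeba.Puiseux n))) ∧
        Amoeba.IsSolid (Amoeba.amoeba Amoeba.valP f) (Amoeba.newtonPolytope f) ∧
        (ENat.card (ConnectedComponents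
            ((Amoeba.coamoeba Amoeba.argP f)ᶜ : Set (Fin n → Circle))) : ℝ≥0∞) =
          n ! * MeasureTheory.volume (Amoeba.newtonPolytope f) ∧
        (ENat.card (ConnectedComponents
            ((closure (Amoeba.coamoeba Amoeba.argP f))ᶜ : Set (Fin n → Circle))) : ℝ≥0∞) =
          n ! * MeasureTheory.volume (Amoeba.newtonPolytope f)) := by
  refine ⟨fun f hf hv => ?_, fun f hf hv => ?_⟩
  · exact Amoeba.amoeba_and_coamoeba_of_simplex Amoeba.logC_mul Amoeba.argCHom Circle.toUnits
      Amoeba.argC_toUnits Amoeba.exists_pow_eq_complex Amoeba.compl_amoeba_stdPoly_complex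
      Amoeba.isOpen_dominated Amoeba.isConnected_dominated
      (fun i j hij => (Amoeba.disjoint_tropDominated hij).mono
        (Amoeba.dominated_subset_tropDominated i) (Amoeba.dominated_subset_tropDominated j))
      ((congrArg _ Amoeba.coamoeba_stdPoly_complex).trans Amoeba.compl_posRelation) subset_rfl
      Amoeba.isConnected_phaseDiff_halfBox
      ((congrArg _ Amoeba.coamoeba_stdPoly_complex).trans Amoeba.closure_posRelation) f hf hv
  · exact Amoeba.amoeba_and_coamoeba_of_simplex Amoeba.valP_mul Amoeba.argPHom Amoeba.constCircle
      Amoeba.argP_constCircle Amoeba.exists_pow_eq_puiseux Amoeba.compl_amoeba_stdPoly_puiseux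
      Amoeba.isOpen_tropDominated Amoeba.isConnected_tropDominated
      (fun i j hij => Amoeba.disjoint_tropDominated hij)
      ((congrArg _ Amoeba.coamoeba_stdPoly_puiseux).trans Amoeba.compl_nonnegRelation)
      Amoeba.openBox_subset_halfBox Amoeba.isConnected_phaseDiff_openBox
      ((congrArg _ Amoeba.coamoeba_stdPoly_puiseux).trans
        Amoeba.isClosed_nonnegRelation.closure_eq) f hf hv
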